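/- Let $R$ be an associative unital ring, let $\mathrm{Mod}\text{-}R$ be the category of right $R$-modules, and let all classes of modules be closed under isomorphic images. **Notation.** For a cardinal $\kappa$, a module is $<\!\kappa$-presented if it has a presentation with fewer than $\kappa$ generators and fewer than $\kappa$ relations; $\mathcal A^{<\kappa}$ is the class of all $<\!\kappa$-presented modules in $\mathcal A$. $\mathrm{Filt}(\mathcal S)$ is the class of all modules $M$ that have an $\mathcal S$-filtration, that is, an increasing chain of submodules $(M_\alpha\mid\alpha\le\sigma)$, indexed by an ordinal $\sigma$, with $M_0=0$, $M_\sigma=M$, $M_\alpha=\bigcup_{\beta<\alpha}M_\beta$ for each limit ordinal $\alpha\le\sigma$, and $M_{\alpha+1}/M_\alpha$ isomorphic to a module in $\mathcal S$ for each $\alpha<\sigma$. A directed system of modules $(M_i,f_{ji}\colon M_i\to M_j\mid i\le j\in I)$ is $\xi$-continuous if each nonempty totally ordered $J\subseteq I$ with $|J|<\xi$ has a supremum in $I$ and $M_{\sup J}=\varinjlim_{j\in J}M_j$ (via the maps of the system); it is well-ordered if $I$ is. **Assumption $(*)$.** For each infinite regular cardinal $\theta$, there is a proper class of cardinals $\kappa$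 such that $\kappa^{<\theta}=\kappa$ and there exists a stationary set $E\subseteq\kappa^+$ consisting of ordinals of cofinality $\theta$ which is non-reflecting, i.e. $E\cap\delta$ is non-stationary in $\delta$ for each ordinal $\delta<\kappa^+$ of uncountable cofinality. **Theorem.** Assume $(*)$. Let $\mathcal A\subseteq\mathrm{Mod}\text{-}R$ be a class of modules and $\xi$ an uncountable regular cardinal such that $\mathcal A=\mathrm{Filt}(\mathcal A^{<\xi})$. Suppose that $\mathcal A$ is closed under direct summands and that the direct limit of each $\xi$-continuous well-ordered directed system consisting of modules from $\mathcal A$ and monomorphisms between them belongs to $\mathcal A$. Then $\mathcal A$ is closed under direct limits: the direct limit of every directed system of modules from $\mathcal A$ belongs to $\mathcal A$. -/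

import Mathlib

open CategoryTheory CategoryTheory.Limits Cardinal

universe u

/-! ### The set-theoretic hypothesis -/

/-- `E ∩ δ` is a stationary subset of the ordinal `δ`, i.e. it meets every closed unbounded subset
of `δ`. Here `δ` is identified with the well-ordered set of all ordinals smaller than `δ`. -/
def StationaryIn (E : Set Ordinal.{u}) (δ : Ordinal.{u}) : Prop :=
  IsStationary {a : Set.Iio δ | (a : Ordinal.{u}) ∈ E}

/-- `E` is a non-reflecting stationary subset of `κ⁺`: it is stationary in `κ⁺` and `E ∩ δ` is
non-stationary in `δ` for each ordinal `δ < κ⁺` of uncountable cofinality. -/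
structure IsNonreflectingStationary (κ : Cardinal.{u}) (E : Set Ordinal.{u}) : Prop where
  subset : ∀ α ∈ E, α < (Order.succ κ).ord
  stationary : StationaryIn E (Order.succ κ).ord
  nonreflecting : ∀ δ : Ordinal.{u}, δ < (Order.succ κ).ord → ℵ₀ < δ.cof → ¬ StationaryIn E δ

/-- The assumption `(∗)`: for each infinite regular cardinal `θ` there is a proper class of (that
is, there are arbitrarily large) cardinals `κ` such that `κ ^ (< θ) = κ` and there is a
non-reflecting stationary set `E ⊆ κ⁺` consisting of ordinals of cofinality `θ`. -/
def AssumptionStar : Prop :=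
  ∀ θ : Cardinal.{u}, θ.IsRegular → ∀ μ : Cardinal.{u}, ∃ κ : Cardinal.{u}, μ ≤ κ ∧
    (∃ E : Set Ordinal.{u}, IsNonreflectingStationary κ E ∧ ∀ α ∈ E, α.cof = θ) ∧
    κ ^< θ = κ

/-! ### Presentations and filtrations of modules -/

section Modules

variable {S : Type u} [Ring S]

/-- `M` is `< κ`-presented: it has fewer than `κ` generators whose module of relations is generated
by fewer than `κ` elements. -/
def IsLTPresented (κ : Cardinal.{u}) (M : ModuleCat.{u} S) : Prop :=
  ∃ (I : Type u) (f : (I →₀ S) →ₗ[S] M) (X : Set (I →₀ S)),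
    #I < κ ∧ #X < κ ∧ Function.Surjective f ∧ LinearMap.ker f = Submodule.span S X

/-- The subclass of all `< κ`-presented modules in the class `A`. -/
def ltPresentedPart (A : ObjectProperty (ModuleCat.{u} S)) (κ : Cardinal.{u}) :
    ObjectProperty (ModuleCat.{u} S) :=
  fun M => A M ∧ IsLTPresented κ M

/-- `(F α ∣ α ≤ σ)` is an `A`-filtration of the module `M`; the values `F α` for `α > σ` are
irrelevant. -/
structure IsClassFiltration (A : ObjectProperty (ModuleCat.{u} S)) (M : ModuleCat.{u} S)
    (σ : Ordinal.{u}) (F : Ordinal.{u} → Submodule S M) : Prop where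
  zero : F 0 = ⊥
  top : F σ = ⊤
  mono : ∀ α β : Ordinal.{u}, α ≤ β → β ≤ σ → F α ≤ F β
  limit : ∀ α : Ordinal.{u}, Order.IsSuccLimit α → α ≤ σ →
    (F α : Set M) = ⋃ β : Set.Iio α, (F β : Set M)
  factor : ∀ α : Ordinal.{u}, α < σ → ∃ B : ModuleCat.{u} S, A B ∧
    Nonempty ((F (Order.succ α) ⧸ (F α).submoduleOf (F (Order.succ α))) ≃ₗ[S] B)

/-- The class of all `A`-filtered modules. -/
def Filt (A : ObjectProperty (ModuleCat.{u} S)) : ObjectProperty (ModuleCat.{u} S) :=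
  fun M => ∃ (σ : Ordinal.{u}) (F : Ordinal.{u} → Submodule S M), IsClassFiltration A M σ F

/-! ### Closure properties of classes of modules -/

/-- `A` contains each direct summand of each of its members. -/
def ClosedUnderDirectSummands (A : ObjectProperty (ModuleCat.{u} S)) : Prop :=
  ∀ M N K : ModuleCat.{u} S, A M → Nonempty (M ≃ₗ[S] (N × K)) → A N

/-- The restriction of the system `F` to a subset `J` of the index set. -/
abbrev restrictSystem {I : Type u} [PartialOrder I] (F : I ⥤ ModuleCat.{u} S) (J : Set I) :
    J ⥤ ModuleCat.{u} S :=
  (Subtype.mono_coe (· ∈ J)).functor ⋙ F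

/-- For an upper bound `s` of `J`, the maps `F j ⟶ F s` (`j ∈ J`), as a cocone over the restriction
of `F` to `J`. -/
def restrictCocone {I : Type u} [PartialOrder I] (F : I ⥤ ModuleCat.{u} S) (J : Set I)
    (s : I) (hs : s ∈ upperBounds J) : Cocone (restrictSystem F J) where
  pt := F.obj s
  ι :=
    { app := fun j => F.map (homOfLE (hs j.2))
      naturality := fun _ _ _ => (F.map_comp _ _).symm.trans (Category.comp_id _).symm }

/-- The system `F` is `κ`-continuous: each nonempty totally ordered set `J` of fewer than `κ`
indices has a supremum `s`, and `F s`, with the maps of the system, is the direct limit of the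
`F j`, `j ∈ J`. -/
def IsContinuousSystem (κ : Cardinal.{u}) {I : Type u} [PartialOrder I]
    (F : I ⥤ ModuleCat.{u} S) : Prop :=
  ∀ J : Set I, J.Nonempty → IsChain (· ≤ ·) J → #J < κ →
    ∃ (s : I) (hs : IsLUB J s), Nonempty (IsColimit (restrictCocone F J s hs.1))

/-- `A` is closed under direct limits of `κ`-continuous well-ordered directed systems of modules and
monomorphisms. -/
def ClosedUnderContinuousMonoWellOrderedLimits (κ : Cardinal.{u})
    (A : ObjectProperty (ModuleCat.{u} S)) : Prop :=
  ∀ (I : Type u) [LinearOrder I] [WellFoundedLT I] [Nonempty I] (F : I ⥤ ModuleCat.{u} S),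
    IsContinuousSystem κ F →
    (∀ (i j : I) (h : i ≤ j), Function.Injective (F.map (homOfLE h))) →
    (∀ i, A (F.obj i)) →
    ∀ c : Cocone F, Nonempty (IsColimit c) → A c.pt

/-- `A` is closed under direct limits of arbitrary directed systems. -/
def ClosedUnderDirectLimits (A : ObjectProperty (ModuleCat.{u} S)) : Prop :=
  ∀ (I : Type u) [PartialOrder I] [IsDirectedOrder I] [Nonempty I] (F : I ⥤ ModuleCat.{u} S),
    (∀ i, A (F.obj i)) →
    ∀ c : Cocone F, Nonempty (IsColimit c) → A c.pt

end Modules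

/-! The first reduction is to chains. By induction on the size of the index set, an infinite
directed set is the union of an increasing chain, of regular length θ, of smaller directed subsets
(`exists_chain_directedOn`). So it suffices to treat a system (G_a | a < θ) of members of A with
direct limit N, knowing that the limits of its proper initial segments are in A
(`mem_of_isDirLim_chain`).

For such a system, N is exhibited as a summand of a quotient that lies in A. Take κ large and E ⊆ κ⁺
as in the set-theoretic assumption, and for each δ ∈ E a ladder η_δ of length θ cofinal in δ. In the
product of copies of the G_c over the nodes of the tree of sequences in κ⁺, an element x of G_a is
spread along a path by its images f_{ac}(x). Let L_α be generated by such elements along the short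
(length < θ) sequences bounded below α and along the ladders η_δ with δ ∈ E, δ < α; let L be the
union of the continuous chain (L_α | α < κ⁺). Three facts finish the proof.

(1) Each L_α is in A. As E does not reflect, the ladders below α become disjoint once suitable
initial segments are removed (`IsNonreflectingStationary.exists_separation`). Then L_α has a
filtration whose factors are zero, limits of initial segments of the system, or direct sums of the
G_a (`ClosedUnderFiltrations.pathGens_mem`). Hence L is in A, by the closure hypothesis on
continuous chains.

(2) L is filtered by < ξ-presented members of A and each L_α has at most κ generators. A Hill-type
closing-off argument, with the stationarity of E, gives α ∈ E with L/L_α in A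
(`PresentedFiltration.exists_quotient_mem`).

(3) For α ∈ E, the ladder η_α itself generates a copy of N in L/L_α, and this copy is a direct
summand (`exists_isDirLim_summand`). So N is in A. -/

/-! ### Filtrations indexed by well-orders and their transitivity -/

section Filtrations

variable {S : Type u} [Ring S]

/-- `B` is isomorphic to `W / (W ∩ U)`. -/
def IsFactor {L : Type u} [AddCommGroup L] [Module S L] (U W : Submodule S L)
    (B : Type u) [AddCommGroup B] [Module S B] : Prop :=
  ∃ q : W →ₗ[S] B, Function.Surjective q ∧ ∀ x, q x = 0 ↔ (x : L) ∈ U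

theorem IsFactor.nonempty_equiv {L : Type u} [AddCommGroup L] [Module S L] {U W P : Submodule S L}
    {B : Type u} [AddCommGroup B] [Module S B] (h : IsFactor U W B) (hP : P = W ⊔ U) :
    Nonempty ((P ⧸ U.submoduleOf P) ≃ₗ[S] B) := by
  subst hP
  obtain ⟨q, hq, hq0⟩ := h
  have hker : LinearMap.ker q = Submodule.comap W.subtype (W ⊓ U) := by
    ext x; simp [hq0]
  exact ⟨(LinearMap.quotientInfEquivSupQuotient W U).symm.trans
    ((Submodule.quotEquivOfEq _ _ hker.symm).trans (q.quotKerEquivOfSurjective hq))⟩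

theorem isFactor_range {L X B : Type u} [AddCommGroup L] [Module S L] [AddCommGroup X] [Module S X]
    [AddCommGroup B] [Module S B] (U : Submodule S L) (p : X →ₗ[S] L) (q : X →ₗ[S] B)
    (hq : Function.Surjective q) (h : ∀ x, q x = 0 ↔ p x ∈ U) :
    IsFactor U (LinearMap.range p) B := by
  have hk : LinearMap.ker p ≤ LinearMap.ker q := fun x hx => by
    rw [LinearMap.mem_ker] at hx ⊢
    rw [h, hx]; exact U.zero_mem
  let e := p.quotKerEquivRange
  have he : ∀ x, e.symm ⟨p x, x, rfl⟩ = (LinearMap.ker p).mkQ x := fun x => by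
    rw [LinearEquiv.symm_apply_eq]; rfl
  refine ⟨(LinearMap.ker p).liftQ q hk ∘ₗ e.symm.toLinearMap, fun b => ?_, ?_⟩
  · obtain ⟨x, rfl⟩ := hq b
    exact ⟨⟨p x, x, rfl⟩, by simp [he]⟩
  · rintro ⟨_, x, rfl⟩
    simp [he, h]

/-- `L` has a filtration indexed by a well-order, given by generating submodules, with factors
in `A`. -/
def HasFiltration (A : ObjectProperty (ModuleCat.{u} S)) (L : Type u) [AddCommGroup L]
    [Module S L] : Prop :=
  ∃ (J : Type u) (_ : LinearOrder J) (_ : WellFoundedLT J) (W : J → Submodule S L),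
    ⨆ j, W j = ⊤ ∧ ∀ j, ∃ B : ModuleCat.{u} S, A B ∧ IsFactor (⨆ i < j, W i) (W j) B

/-- With index i carrying F (i + 1), the terms before o sum to F o: at a successor the last term is
F o, at a limit this is continuity. Limit stages need no separate bookkeeping afterwards. -/
theorem IsClassFiltration.iSup_eq {A : ObjectProperty (ModuleCat.{u} S)} {M : ModuleCat.{u} S}
    {σ : Ordinal.{u}} {F : Ordinal.{u} → Submodule S M} (h : IsClassFiltration A M σ F)
    (o : Ordinal.{u}) (ho : o ≤ σ) :
    ⨆ (i : σ.ToType) (_ : (Ordinal.ToType.mk.symm i : Ordinal.{u}) < o),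
      F (Order.succ (Ordinal.ToType.mk.symm i : Ordinal.{u})) = F o := by
  have hle : ⨆ (i : σ.ToType) (_ : (Ordinal.ToType.mk.symm i : Ordinal.{u}) < o),
      F (Order.succ (Ordinal.ToType.mk.symm i : Ordinal.{u})) ≤ F o :=
    iSup₂_le fun i hi => h.mono _ _ (Order.succ_le_of_lt hi) ho
  refine le_antisymm hle ?_
  have key : ∀ β < o, F (Order.succ β) ≤ ⨆ (i : σ.ToType)
      (_ : (Ordinal.ToType.mk.symm i : Ordinal.{u}) < o),
      F (Order.succ (Ordinal.ToType.mk.symm i : Ordinal.{u})) := fun β hβ => by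
    have := le_iSup₂ (f := fun (i : σ.ToType)
      (_ : (Ordinal.ToType.mk.symm i : Ordinal.{u}) < o) =>
      F (Order.succ (Ordinal.ToType.mk.symm i : Ordinal.{u})))
      (Ordinal.ToType.mk ⟨β, hβ.trans_le ho⟩) (by simpa using hβ)
    simpa using this
  rcases Ordinal.zero_or_succ_or_isSuccLimit o with rfl | ⟨β, rfl⟩ | hl
  · rw [h.zero]; exact bot_le
  · exact key β (Order.lt_succ β)
  · intro x hx
    have hx' : x ∈ (F o : Set M) := hx
    rw [h.limit o hl ho] at hx'
    obtain ⟨⟨β, hβ⟩, hx'⟩ := Set.mem_iUnion.1 hx'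
    have hβ' : β < o := hβ
    exact key β hβ' (h.mono _ _ (Order.le_succ β)
      ((Order.succ_le_of_lt hβ').trans ho) hx')

theorem Filt.hasFiltration {A : ObjectProperty (ModuleCat.{u} S)} {M : ModuleCat.{u} S}
    (h : Filt A M) : HasFiltration A M := by
  obtain ⟨σ, F, h⟩ := h
  refine ⟨σ.ToType, inferInstance, inferInstance,
    fun i => F (Order.succ (Ordinal.ToType.mk.symm i : Ordinal.{u})), ?_, fun j => ?_⟩
  · have h1 := h.iSup_eq σ le_rfl
    rw [h.top] at h1
    rw [eq_top_iff, ← h1]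
    exact iSup_mono fun i => iSup_le fun _ => le_rfl
  · obtain ⟨B, hB, ⟨e⟩⟩ := h.factor (Ordinal.ToType.mk.symm j : Ordinal.{u})
      (Ordinal.ToType.mk.symm j).2
    refine ⟨B, hB, ?_⟩
    have h1 := h.iSup_eq (Ordinal.ToType.mk.symm j) (Ordinal.ToType.mk.symm j).2.le
    simp only [Subtype.coe_lt_coe, OrderIso.lt_iff_lt] at h1
    rw [h1]
    refine ⟨e.toLinearMap ∘ₗ Submodule.mkQ _, e.surjective.comp (Submodule.mkQ_surjective _),
      fun x => ?_⟩
    exact e.map_eq_zero_iff.trans (Submodule.Quotient.mk_eq_zero _)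

theorem HasFiltration.filt {A : ObjectProperty (ModuleCat.{u} S)} {L : Type u} [AddCommGroup L]
    [Module S L] (h : HasFiltration A L) : Filt A (ModuleCat.of S L) := by
  obtain ⟨J, _, _, W, htop, hW⟩ := h
  let r : J → Ordinal.{u} := Ordinal.typein (· < ·)
  have hr : ∀ i j, r i < r j ↔ i < j := fun i j => Ordinal.typein_lt_typein _
  refine ⟨Ordinal.type (α := J) (· < ·), fun α => ⨆ (j : J) (_ : r j < α), W j, ?_⟩
  refine ⟨?_, ?_, ?_, ?_, ?_⟩
  · simp
  · rw [eq_top_iff]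
    change (⊤ : Submodule S L) ≤ _
    rw [← htop]
    exact iSup_mono fun j => le_iSup_of_le (Ordinal.typein_lt_type _ j) le_rfl
  · intro α β hαβ _
    exact iSup_mono fun j => iSup_le fun hj => le_iSup_of_le (hj.trans_le hαβ) le_rfl
  · intro α hα _
    ext x
    simp only [Set.mem_iUnion, SetLike.mem_coe]
    constructor
    · intro hx
      have h1 : (⨆ (j : J) (_ : r j < α), W j) ≤
          ⨆ β : Set.Iio α, ⨆ (j : J) (_ : r j < β), W j :=
        iSup₂_le fun j hj => le_iSup_of_le (ι := Set.Iio α) ⟨Order.succ (r j), hα.succ_lt hj⟩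
          (le_iSup₂_of_le (f := fun j (_ : r j < Order.succ (r _)) => W j) j
            (Order.lt_succ _) le_rfl)
      have : Nonempty (Set.Iio α) := ⟨⟨0, hα.bot_lt⟩⟩
      refine (Submodule.mem_iSup_of_directed _ ?_).1 (h1 hx)
      refine Monotone.directed_le fun β γ hβγ => ?_
      exact iSup_mono fun j => iSup_le fun hj =>
        le_iSup_of_le (lt_of_lt_of_le hj (Subtype.coe_le_coe.2 hβγ)) le_rfl
    · rintro ⟨β, hx⟩
      have h1 : (⨆ (j : J) (_ : r j < β), W j) ≤ ⨆ (j : J) (_ : r j < α), W j :=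
        iSup_mono fun j => iSup_le fun hj => le_iSup_of_le (lt_trans hj β.2) le_rfl
      exact h1 hx
  · intro α hα
    obtain ⟨j, rfl⟩ : ∃ j, r j = α := Ordinal.typein_surj _ hα
    obtain ⟨B, hB, hf⟩ := hW j
    refine ⟨B, hB, ?_⟩
    simp only [← hr] at hf
    refine hf.nonempty_equiv ?_
    simp only [Order.lt_succ_iff_eq_or_lt, iSup_or, iSup_sup_eq]
    congr 1
    refine le_antisymm (iSup₂_le fun i hi => ?_) (le_iSup₂_of_le j rfl le_rfl)
    rw [Ordinal.typein_inj] at hi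
    exact hi ▸ le_rfl

/-- The filtration of each factor is pulled back along `q j` into `W j`, and the resulting pieces
are ordered lexicographically. What precedes (j, k) is the sum of all earlier `W i` and of the
earlier pieces over j, so the new factors are those of the inner filtrations. -/
theorem HasFiltration.trans {A : ObjectProperty (ModuleCat.{u} S)} {L : Type u} [AddCommGroup L]
    [Module S L] (h : HasFiltration (Filt A) L) : HasFiltration A L := by
  obtain ⟨J, _, _, W, htop, hW⟩ := h
  choose B hB q hq hq0 using hW
  choose K o1 o2 V hVtop hV using fun j => (hB j).hasFiltration
  let Z : (Σₗ j, K j) → Submodule S L := fun p =>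
    ((V (ofLex p).1 (ofLex p).2).comap (q (ofLex p).1)).map (W (ofLex p).1).subtype
  have hmq : ∀ j k, ((V j k).comap (q j)).map (q j) = V j k := fun j k =>
    Submodule.map_comap_eq_of_surjective (hq j) _
  have hZW : ∀ j k, Z (toLex ⟨j, k⟩) ≤ W j := fun j k => Submodule.map_subtype_le _ _
  have hWle : ∀ j, W j ≤ (⨆ i < j, W i) ⊔ ⨆ k, Z (toLex ⟨j, k⟩) := by
    intro j x hx
    have h1 : q j ⟨x, hx⟩ ∈ (⨆ k, (V j k).comap (q j)).map (q j) := by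
      rw [Submodule.map_iSup]; simp only [hmq, hVtop]; trivial
    obtain ⟨y, hy, hxy⟩ := h1
    have h2 : x - y ∈ ⨆ i < j, W i := by
      have := (hq0 j (⟨x, hx⟩ - y)).1 (by rw [map_sub, hxy, sub_self])
      simpa using this
    have h3 : (y : L) ∈ ⨆ k, Z (toLex ⟨j, k⟩) := by
      have : (W j).subtype y ∈ (⨆ k, (V j k).comap (q j)).map (W j).subtype :=
        Submodule.mem_map_of_mem hy
      rwa [Submodule.map_iSup] at this
    have := Submodule.add_mem_sup h2 h3
    simpa using this
  have hU : ∀ j, W j ≤ ⨆ i ≤ j, ⨆ k, Z (toLex ⟨i, k⟩) := by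
    intro j
    induction j using WellFoundedLT.induction with
    | ind j ih =>
      refine (hWle j).trans (sup_le (iSup₂_le fun i hi => (ih i hi).trans ?_) ?_)
      · exact iSup₂_le fun i' hi' => le_iSup₂_of_le i' (hi'.trans hi.le) le_rfl
      · exact le_iSup₂_of_le j le_rfl le_rfl
  refine ⟨Σₗ j, K j, inferInstance, ?_, Z, ?_, ?_⟩
  · exact ⟨Subrelation.wf (fun {a b} h => by
      rcases h with ⟨_, _, h⟩ | ⟨_, _, h⟩
      exacts [PSigma.Lex.left _ _ h, PSigma.Lex.right _ h]) (InvImage.wf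
        (fun p : Σ j, K j => (⟨p.1, p.2⟩ : Σ' j, K j))
        (WellFounded.psigma_lex (wellFounded_lt (α := J)) fun j => (o2 j).wf))⟩
  · rw [eq_top_iff, ← htop]
    refine iSup_le fun j => (hU j).trans (iSup₂_le fun i _ => iSup_le fun k => ?_)
    exact le_iSup Z (toLex ⟨i, k⟩)
  · refine Lex.rec ?_
    rintro ⟨j, k⟩
    obtain ⟨C, hC, r, hr, hr0⟩ := hV j k
    refine ⟨C, hC, ?_⟩
    have hlt : ⨆ p < (toLex ⟨j, k⟩ : Σₗ j, K j), Z p =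
        (⨆ i < j, W i) ⊔ ⨆ k' < k, Z (toLex ⟨j, k'⟩) := by
      refine le_antisymm (iSup₂_le ?_) (sup_le (iSup₂_le fun i hi => (hU i).trans ?_)
        (iSup₂_le fun k' hk' => ?_))
      · refine Lex.rec ?_
        rintro ⟨i, l⟩ hil
        rcases Sigma.Lex.lt_def.1 hil with hij | ⟨hij, hlk⟩
        · exact le_sup_of_le_left (le_iSup₂_of_le i hij (hZW i l))
        · change i = j at hij
          subst hij
          exact le_sup_of_le_right (le_iSup₂_of_le l hlk le_rfl)
      · refine iSup₂_le fun i' hi' => iSup_le fun l => ?_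
        exact le_iSup₂_of_le (f := fun p (_ : p < (toLex ⟨j, k⟩ : Σₗ j, K j)) => Z p) (toLex ⟨i', l⟩)
          (Sigma.Lex.lt_def.2 (Or.inl (hi'.trans_lt hi))) le_rfl
      · exact le_iSup₂_of_le (f := fun p (_ : p < (toLex ⟨j, k⟩ : Σₗ j, K j)) => Z p) (toLex ⟨j, k'⟩)
          (Sigma.Lex.lt_def.2 (Or.inr ⟨rfl, hk'⟩)) le_rfl
    rw [hlt]
    have hrange : Z (toLex ⟨j, k⟩) =
        LinearMap.range ((W j).subtype ∘ₗ ((V j k).comap (q j)).subtype) := by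
      change ((V j k).comap (q j)).map (W j).subtype = _
      rw [LinearMap.range_comp, Submodule.range_subtype]
    rw [hrange]
    refine isFactor_range _ _ (r ∘ₗ (q j).restrict (p := (V j k).comap (q j)) (q := V j k)
      fun x hx => hx) (hr.comp ?_) ?_
    · rintro ⟨y, hy⟩
      obtain ⟨x, rfl⟩ := hq j y
      exact ⟨⟨x, hy⟩, rfl⟩
    · rintro ⟨x, hx⟩
      rw [LinearMap.comp_apply, hr0]
      change q j x ∈ _ ↔ (x : L) ∈ _
      have h1 : ⨆ k' < k, V j k' = (⨆ k' < k, (V j k').comap (q j)).map (q j) := by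
        simp only [Submodule.map_iSup, hmq]
      have h2 : ⨆ k' < k, Z (toLex ⟨j, k'⟩) = (⨆ k' < k, (V j k').comap (q j)).map (W j).subtype := by
        simp only [Submodule.map_iSup]
        rfl
      rw [h1, h2]
      constructor
      · rintro ⟨y, hy, hxy⟩
        have h3 : (x : L) - y ∈ ⨆ i < j, W i := by
          have := (hq0 j (x - y)).1 (by rw [map_sub, hxy, sub_self])
          simpa using this
        have := Submodule.add_mem_sup h3 (Submodule.mem_map_of_mem (f := (W j).subtype) hy)
        simpa using this
      · intro h
        obtain ⟨a, ha, _, ⟨y, hy, rfl⟩, hay⟩ := Submodule.mem_sup.1 h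
        refine ⟨y, hy, ?_⟩
        rw [eq_comm, ← sub_eq_zero, ← map_sub, hq0]
        have : ((x - y : W j) : L) = a := by
          rw [Submodule.coe_sub, ← hay]; simp
        rwa [this]

end Filtrations

theorem mk_iUnion_le_of_le {ι α : Type u} {κ : Cardinal.{u}} (hκ : ℵ₀ ≤ κ) (f : ι → Set α)
    (hι : #ι ≤ κ) (hf : ∀ i, #(f i) ≤ κ) : #(⋃ i, f i) ≤ κ :=
  (mk_iUnion_le f).trans ((mul_le_mul' hι (ciSup_le' hf)).trans (mul_eq_self hκ).le)

theorem mk_biUnion_le_of_le' {ι α : Type u} {κ : Cardinal.{u}} (hκ : ℵ₀ ≤ κ) (s : Set ι)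
    (f : ι → Set α) (hι : #s ≤ κ) (hf : ∀ i ∈ s, #(f i) ≤ κ) : #(⋃ i ∈ s, f i : Set α) ≤ κ := by
  rw [Set.biUnion_eq_iUnion]
  exact mk_iUnion_le_of_le hκ _ hι fun i => hf i i.2

/-! ### Classes closed under filtrations -/

section ClosedFiltrations

variable {S : Type u} [Ring S]

/-- `A` contains each module with a filtration with factors in `A`. -/
def ClosedUnderFiltrations (A : ObjectProperty (ModuleCat.{u} S)) : Prop :=
  ∀ (L : Type u) [AddCommGroup L] [Module S L], HasFiltration A L → A (ModuleCat.of S L)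

theorem closedUnderFiltrations_of_eq_filt {A C : ObjectProperty (ModuleCat.{u} S)}
    (h : A = Filt C) : ClosedUnderFiltrations A := by
  subst h
  intro L _ _ hL
  exact hL.trans.filt

variable {A : ObjectProperty (ModuleCat.{u} S)}

theorem ClosedUnderFiltrations.of_subsingleton (hA : ClosedUnderFiltrations A) (L : Type u)
    [AddCommGroup L] [Module S L] [Subsingleton L] : A (ModuleCat.of S L) :=
  hA L ⟨PEmpty, inferInstance, inferInstance, fun _ => ⊤, Subsingleton.elim _ _, fun j => j.elim⟩

theorem ClosedUnderFiltrations.of_equiv (hA : ClosedUnderFiltrations A) {L L' : Type u}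
    [AddCommGroup L] [Module S L] [AddCommGroup L'] [Module S L'] (e : L ≃ₗ[S] L')
    (h : A (ModuleCat.of S L)) : A (ModuleCat.of S L') := by
  refine hA L' ⟨PUnit, inferInstance, inferInstance, fun _ => ⊤, by simp, fun j =>
    ⟨_, h, e.symm.toLinearMap ∘ₗ (⊤ : Submodule S L').subtype, ?_, ?_⟩⟩
  · intro y
    exact ⟨⟨e y, trivial⟩, by simp⟩
  · rintro ⟨x, hx⟩
    simp

end ClosedFiltrations

/-! ### Hill-type argument: closed sets of indices of a presented filtration -/

section Hill

variable {S : Type u} [Ring S]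

/-- A filtration of `L` with consecutive factors in `A` together with presentations of the
factors with fewer than `ξ` generators and relations: the `j`-th factor is `(I j →₀ S) / span (X j)`
and `p j` lifts the presentation to `L`. -/
structure PresentedFiltration (A : ObjectProperty (ModuleCat.{u} S)) (ξ : Cardinal.{u})
    (L : Type u) [AddCommGroup L] [Module S L] (J : Type u) [LinearOrder J] where
  I : J → Type u
  X : ∀ j, Set (I j →₀ S)
  p : ∀ j, (I j →₀ S) →ₗ[S] L
  B : J → ModuleCat.{u} S
  f : ∀ j, (I j →₀ S) →ₗ[S] B j
  mk_I : ∀ j, #(I j) < ξ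
  mk_X : ∀ j, #(X j) < ξ
  mem : ∀ j, A (B j)
  surj : ∀ j, Function.Surjective (f j)
  ker : ∀ j, LinearMap.ker (f j) = Submodule.span S (X j)
  f_eq_zero : ∀ j y, f j y = 0 ↔ p j y ∈ ⨆ i < j, LinearMap.range (p i)
  iSup_eq : ⨆ j, LinearMap.range (p j) = ⊤

variable {A : ObjectProperty (ModuleCat.{u} S)} {ξ : Cardinal.{u}} {L : Type u} [AddCommGroup L]
  [Module S L]

/-- The generators of each factor are lifted to `W j`. The range of `p j` may be smaller than `W j`,
but the sums over initial segments of the index set agree, so the factors do not change. -/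
theorem HasFiltration.exists_presentedFiltration (h : HasFiltration (ltPresentedPart A ξ) L) :
    ∃ (J : Type u) (_ : LinearOrder J) (_ : WellFoundedLT J),
      Nonempty (PresentedFiltration A ξ L J) := by
  obtain ⟨J, _, _, W, htop, hW⟩ := h
  choose B hB q hq hq0 using hW
  choose I f X hI hX hf hker using fun j => (hB j).2
  choose g hg using fun j => fun b => hq j (f j (Finsupp.single b 1))
  let l : ∀ j, (I j →₀ S) →ₗ[S] W j := fun j => Finsupp.lift _ S (I j) (g j)
  have hl : ∀ j y, q j (l j y) = f j y := fun j y => by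
    have : q j ∘ₗ l j = f j := by
      ext b
      simp [l, hg]
    exact LinearMap.congr_fun this y
  let p : ∀ j, (I j →₀ S) →ₗ[S] L := fun j => (W j).subtype ∘ₗ l j
  have hpW : ∀ j, LinearMap.range (p j) ≤ W j := by
    rintro j _ ⟨y, rfl⟩
    exact (l j y).2
  have hWp : ∀ j, W j ≤ ⨆ i ≤ j, LinearMap.range (p i) := by
    intro j
    induction j using WellFoundedLT.induction with
    | ind j ih =>
      intro x hx
      obtain ⟨y, hy⟩ := hf j (q j ⟨x, hx⟩)
      have h1 : x - p j y ∈ ⨆ i < j, W i := by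
        have := (hq0 j (⟨x, hx⟩ - l j y)).1 (by rw [map_sub, hl, hy, sub_self])
        exact this
      have h2 : (⨆ i < j, W i) ≤ ⨆ i ≤ j, LinearMap.range (p i) :=
        iSup₂_le fun i hi => (ih i hi).trans
          (iSup₂_le fun i' hi' => le_iSup₂_of_le i' (hi'.trans hi.le) le_rfl)
      have h3 : p j y ∈ ⨆ i ≤ j, LinearMap.range (p i) :=
        (le_iSup₂_of_le (f := fun i (_ : i ≤ j) => LinearMap.range (p i)) j le_rfl le_rfl) ⟨y, rfl⟩
      simpa using Submodule.add_mem _ (h2 h1) h3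
  have hlt : ∀ j, ⨆ i < j, W i = ⨆ i < j, LinearMap.range (p i) := fun j => by
    refine le_antisymm (iSup₂_le fun i hi => (hWp i).trans
      (iSup₂_le fun i' hi' => le_iSup₂_of_le i' (hi'.trans_lt hi) le_rfl))
      (iSup₂_mono fun i hi => hpW i)
  refine ⟨J, inferInstance, inferInstance, ⟨⟨I, X, p, B, f, hI, hX, fun j => (hB j).1, hf, hker,
    fun j y => ?_, ?_⟩⟩⟩
  · rw [← hl, hq0, hlt]; rfl
  · rw [eq_top_iff, ← htop]
    exact iSup_le fun j => (hWp j).trans (iSup₂_le fun i _ => le_iSup (fun i =>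
      LinearMap.range (p i)) i)

namespace PresentedFiltration

variable {J : Type u} [LinearOrder J] (P : PresentedFiltration A ξ L J)

/-- The submodule generated by the generators with index in `T`. -/
noncomputable def spanned (T : Set J) : Submodule S L := ⨆ i ∈ T, LinearMap.range (P.p i)

theorem spanned_mono {T T' : Set J} (h : T ⊆ T') : P.spanned T ≤ P.spanned T' :=
  biSup_mono h

theorem range_le_spanned {T : Set J} {j : J} (h : j ∈ T) : LinearMap.range (P.p j) ≤ P.spanned T :=
  le_iSup₂_of_le (f := fun i (_ : i ∈ T) => LinearMap.range (P.p i)) j h le_rfl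

theorem spanned_iUnion {ι : Sort*} (T : ι → Set J) :
    P.spanned (⋃ i, T i) = ⨆ i, P.spanned (T i) := by
  refine le_antisymm (iSup₂_le fun j hj => ?_)
    (iSup_le fun i => P.spanned_mono (Set.subset_iUnion T i))
  obtain ⟨i, hi⟩ := Set.mem_iUnion.1 hj
  exact le_iSup_of_le i (P.range_le_spanned hi)

theorem mem_span_iff (j : J) (y : P.I j →₀ S) :
    y ∈ Submodule.span S (P.X j) ↔ P.p j y ∈ P.spanned (Set.Iio j) := by
  rw [← P.ker, LinearMap.mem_ker, P.f_eq_zero]; rfl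

/-- A set of indices is closed if the relations of each of its members are witnessed by smaller
members. -/
def IsClosedSet (T : Set J) : Prop :=
  ∀ j ∈ T, ∀ x ∈ P.X j, P.p j x ∈ P.spanned (T ∩ Set.Iio j)

theorem IsClosedSet.iUnion {ι : Sort*} {T : ι → Set J} (h : ∀ i, P.IsClosedSet (T i)) :
    P.IsClosedSet (⋃ i, T i) := by
  intro j hj x hx
  obtain ⟨i, hi⟩ := Set.mem_iUnion.1 hj
  exact P.spanned_mono (Set.inter_subset_inter_left _ (Set.subset_iUnion T i)) (h i j hi x hx)

theorem eq_zero_or_exists_of_mem_spanned {T : Set J} {m : L} (hm : m ∈ P.spanned T) :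
    m = 0 ∨ ∃ k ∈ T, m ∈ P.spanned (T ∩ Set.Iic k) := by
  rcases isEmpty_or_nonempty T with hT | hT
  · left
    rw [Set.isEmpty_coe_sort] at hT
    subst hT
    simpa [spanned] using hm
  · right
    have h1 : P.spanned T ≤ ⨆ k : T, P.spanned (T ∩ Set.Iic k) := iSup₂_le fun j hj =>
      le_iSup_of_le ⟨j, hj⟩ (P.range_le_spanned ⟨hj, Set.mem_Iic.2 le_rfl⟩)
    obtain ⟨k, hk⟩ := (Submodule.mem_iSup_of_directed (fun k : T => P.spanned (T ∩ Set.Iic k))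
      (Monotone.directed_le fun k k' hkk' =>
      P.spanned_mono (Set.inter_subset_inter_right _ (Set.Iic_subset_Iic.2 hkk')))).1 (h1 hm)
    exact ⟨k, k.2, hk⟩

theorem spanned_inter_Iic_le {T : Set J} {k : J} :
    P.spanned (T ∩ Set.Iic k) ≤ LinearMap.range (P.p k) ⊔ P.spanned (T ∩ Set.Iio k) := by
  refine iSup₂_le fun i hi => ?_
  rcases eq_or_lt_of_le (Set.mem_Iic.1 hi.2) with rfl | h
  · exact le_sup_left
  · exact le_sup_of_le_right (P.range_le_spanned ⟨hi.1, h⟩)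

theorem exists_finset_of_mem_spanned {T : Set J} {m : L} (hm : m ∈ P.spanned T) :
    ∃ s : Finset J, ↑s ⊆ T ∧ m ∈ P.spanned (s : Set J) := by
  classical
  rw [spanned, iSup_subtype', Submodule.mem_iSup_iff_exists_finset] at hm
  obtain ⟨s, hs⟩ := hm
  refine ⟨s.image Subtype.val, by simp, ?_⟩
  refine (iSup₂_le fun i hi => P.range_le_spanned ?_ : _ ≤ P.spanned _) hs
  simpa using hi

/-- Each set of indices of size at most `κ` is contained in a closed one. -/
theorem exists_isClosedSet {κ : Cardinal.{u}} (hκ : ℵ₀ ≤ κ) (hξκ : ξ ≤ κ) (T : Set J)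
    (hT : #T ≤ κ) : ∃ T' : Set J, T ⊆ T' ∧ #T' ≤ κ ∧ P.IsClosedSet T' := by
  have h0 : ∀ j, ∀ x : P.X j, ∃ s : Finset J, ↑s ⊆ Set.Iio j ∧
      P.p j x ∈ P.spanned (s : Set J) := fun j x =>
    P.exists_finset_of_mem_spanned ((P.mem_span_iff j x).1 (Submodule.subset_span x.2))
  choose s hs hs' using h0
  -- One round adds finite witnesses for all relations of the members of T. Countably many rounds
  -- close the set without exceeding κ.
  let D : Set J → Set J := fun T => T ∪ ⋃ j ∈ T, ⋃ x, (s j x : Set J)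
  have hD : ∀ T : Set J, #T ≤ κ → #(D T) ≤ κ := fun T hT => by
    refine (mk_union_le _ _).trans ((add_le_add hT ?_).trans (add_eq_self hκ).le)
    exact mk_biUnion_le_of_le' hκ _ _ hT fun j _ => mk_iUnion_le_of_le hκ _
      ((P.mk_X j).le.trans hξκ) fun x => (lt_aleph0_of_finite _).le.trans hκ
  refine ⟨⋃ n : ℕ, D^[n] T, Set.subset_iUnion (fun n : ℕ => D^[n] T) 0, ?_, ?_⟩
  · have h1 : ∀ n : ℕ, #(D^[n] T : Set J) ≤ κ := fun n => by
      induction n with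
      | zero => exact hT
      | succ n ih => rw [Function.iterate_succ_apply']; exact hD _ ih
    have h2 := mk_iUnion_le_of_le hκ (fun n : ULift.{u} ℕ => D^[n.down] T) (by simpa using hκ)
      fun n => h1 _
    have h3 : (⋃ n : ULift.{u} ℕ, D^[n.down] T) = ⋃ n : ℕ, D^[n] T := by
      ext x; simp [ULift.exists]
    rwa [h3] at h2
  · intro j hj x hx
    obtain ⟨n, hn⟩ := Set.mem_iUnion.1 hj
    refine P.spanned_mono ?_ (hs' j ⟨x, hx⟩)
    intro i hi
    refine ⟨Set.mem_iUnion.2 ⟨n + 1, ?_⟩, hs j ⟨x, hx⟩ hi⟩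
    rw [Function.iterate_succ_apply']
    exact Or.inr (Set.mem_biUnion hn (Set.mem_iUnion.2 ⟨_, hi⟩))

/-- The submodule spanned by a small set of indices is generated by a small set. -/
theorem exists_spanned_eq_span {κ : Cardinal.{u}} (hκ : ℵ₀ ≤ κ) (hξκ : ξ ≤ κ) (T : Set J)
    (hT : #T ≤ κ) : ∃ Z : Set L, #Z ≤ κ ∧ P.spanned T = Submodule.span S Z := by
  refine ⟨⋃ j ∈ T, Set.range fun b => P.p j (Finsupp.single b 1), ?_, ?_⟩
  · exact mk_biUnion_le_of_le' hκ _ _ hT fun j _ =>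
      mk_range_le.trans ((P.mk_I j).le.trans hξκ)
  · simp only [Submodule.span_iUnion, spanned]
    congr! 3 with j
    rw [Set.range_comp' (P.p j), ← Submodule.map_span, LinearMap.range_eq_map]
    congr 1
    exact (Finsupp.basisSingleOne (R := S) (ι := P.I j)).span_eq.symm.trans (by simp)

variable [WellFoundedLT J]

/-- Descent on the top index k needed to write m. If k > j, the component `p k y` lies in the sum of
the earlier ranges, so y is a combination of relations; closedness of T rewrites `p k y` through
smaller members of T. -/
theorem IsClosedSet.mem_spanned_inter {T : Set J} (hT : P.IsClosedSet T) {j : J} {m : L}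
    (hm : m ∈ P.spanned T) (hmj : m ∈ P.spanned (Set.Iic j)) :
    m ∈ P.spanned (T ∩ Set.Iic j) := by
  have key : ∀ k ∈ T, ∀ m ∈ P.spanned (T ∩ Set.Iic k), m ∈ P.spanned (Set.Iic j) →
      m ∈ P.spanned (T ∩ Set.Iic j) := by
    intro k
    induction k using WellFoundedLT.induction with
    | ind k ih =>
      intro hkT m hm hmj
      rcases le_or_gt k j with hkj | hjk
      · exact P.spanned_mono (Set.inter_subset_inter_right _ (Set.Iic_subset_Iic.2 hkj)) hm
      · obtain ⟨_, ⟨y, rfl⟩, m', hm', hmm⟩ := Submodule.mem_sup.1 (P.spanned_inter_Iic_le hm)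
        have h1 : P.p k y ∈ P.spanned (Set.Iio k) := by
          have h2 : P.p k y = m - m' := by rw [← hmm]; abel
          rw [h2]
          exact Submodule.sub_mem _
            (P.spanned_mono (fun i hi => lt_of_le_of_lt (Set.mem_Iic.1 hi) hjk) hmj)
            (P.spanned_mono Set.inter_subset_right hm')
        rw [← P.mem_span_iff] at h1
        have h3 : Submodule.span S (P.X k) ≤ (P.spanned (T ∩ Set.Iio k)).comap (P.p k) :=
          Submodule.span_le.2 fun x hx => hT k hkT x hx
        have h4 : m ∈ P.spanned (T ∩ Set.Iio k) := by
          rw [← hmm]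
          exact Submodule.add_mem _ (h3 h1) hm'
        rcases P.eq_zero_or_exists_of_mem_spanned h4 with rfl | ⟨k', hk', hm''⟩
        · exact Submodule.zero_mem _
        · exact ih k' hk'.2 hk'.1 m (P.spanned_mono
            (Set.inter_subset_inter_left _ Set.inter_subset_left) hm'') hmj
  rcases P.eq_zero_or_exists_of_mem_spanned hm with rfl | ⟨k, hk, hmk⟩
  · exact Submodule.zero_mem _
  · exact key k hk m hmk hmj

/-- The images of the ranges of the `p j` filter the quotient. For j in T the factor becomes zero.
For j outside T it is unchanged: by `mem_spanned_inter`, dividing by `P.spanned T` identifies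
nothing at stage j beyond what members of T below j already identify. -/
theorem IsClosedSet.quotient_mem (hA : ClosedUnderFiltrations A) {T : Set J}
    (hT : P.IsClosedSet T) : A (ModuleCat.of S (L ⧸ P.spanned T)) := by
  refine hA _ ⟨J, inferInstance, inferInstance,
    fun j => LinearMap.range ((P.spanned T).mkQ ∘ₗ P.p j), ?_, fun j => ?_⟩
  · simp only [LinearMap.range_comp]
    rw [← Submodule.map_iSup, P.iSup_eq, Submodule.map_top, Submodule.range_mkQ]
  · by_cases hj : j ∈ T
    · refine ⟨_, hA.of_subsingleton PUnit, isFactor_range _ _ 0 (fun x => ⟨0, rfl⟩) fun x => ?_⟩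
      simp only [LinearMap.zero_apply, true_iff]
      have : ((P.spanned T).mkQ ∘ₗ P.p j) x = 0 := by
        simpa using P.range_le_spanned hj ⟨x, rfl⟩
      rw [this]
      exact Submodule.zero_mem _
    · refine ⟨P.B j, P.mem j, isFactor_range _ _ (P.f j) (P.surj j) fun x => ?_⟩
      rw [P.f_eq_zero]
      simp only [LinearMap.range_comp]
      simp only [← Submodule.map_iSup]
      constructor
      · intro h
        exact ⟨_, h, rfl⟩
      · rintro ⟨y, hy, hxy⟩
        change y ∈ P.spanned (Set.Iio j) at hy
        change P.p j x ∈ P.spanned (Set.Iio j)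
        have h1 : P.p j x - y ∈ P.spanned T := by
          rw [← Submodule.Quotient.mk_eq_zero, Submodule.Quotient.mk_sub, sub_eq_zero]
          exact hxy.symm
        have h2 : P.p j x - y ∈ P.spanned (Set.Iic j) :=
          Submodule.sub_mem _ (P.range_le_spanned (Set.mem_Iic.2 le_rfl) ⟨x, rfl⟩)
            (P.spanned_mono Set.Iio_subset_Iic_self hy)
        have h3 := P.spanned_mono (T' := Set.Iio j) (fun i hi => lt_of_le_of_ne
          (Set.mem_Iic.1 hi.2) (fun h => hj (h ▸ hi.1))) (IsClosedSet.mem_spanned_inter P hT h1 h2)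
        simpa using Submodule.add_mem _ h3 hy

end PresentedFiltration

end Hill

/-! ### Stationary sets and closure points -/

/-- A stationary subset of an ordinal of uncountable cofinality contains a point closed under a
given monotone function. -/
theorem StationaryIn.exists_closed_under {E : Set Ordinal.{u}} {o : Ordinal.{u}}
    (hE : StationaryIn E o) (hcof : ℵ₀ < o.cof) {H : Ordinal.{u} → Ordinal.{u}} (hmono : Monotone H)
    (hH : ∀ β < o, H β < o) : ∃ α ∈ E, α < o ∧ ∀ β < α, H β < α := by
  have hlimit : Order.IsSuccLimit o := Ordinal.one_lt_cof_iff.1 (one_lt_aleph0.trans hcof)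
  have hclub : IsClub {a : Set.Iio o | ∀ β < (a : Ordinal.{u}), H β < a} := by
    constructor
    · intro d hd _ _ a ha β hβ
      obtain ⟨c, hc, hβc⟩ := (lt_isLUB_iff (b := (⟨β, hβ.trans a.2⟩ : Set.Iio o)) ha).1 hβ
      exact (hd hc β hβc).trans_le (ha.1 hc)
    · intro a
      -- Closure points are unbounded: the supremum of the iterates of b ↦ max (H b) b + 1 is one,
      -- and it stays below o because the cofinality is uncountable.
      let G : Ordinal.{u} → Ordinal.{u} := fun b => Order.succ (max (H b) b)
      have hG : ∀ b < o, G b < o := fun b hb => hlimit.succ_lt (max_lt (hH b hb) hb)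
      refine ⟨⟨Ordinal.nfp G a, Ordinal.nfp_lt_ord hcof hG a.2⟩, fun β hβ => ?_,
        Ordinal.le_nfp G a⟩
      obtain ⟨n, hn⟩ := Ordinal.lt_nfp_iff.1 hβ
      refine Ordinal.lt_nfp_iff.2 ⟨n + 1, ?_⟩
      rw [Function.iterate_succ_apply']
      exact Order.lt_succ_of_le ((hmono hn.le).trans (le_max_left _ _))
  obtain ⟨a, ha, ha'⟩ := hE hclub
  exact ⟨a, ha, a.2, ha'⟩

/-! ### Direct limits and chains of submodules of length κ⁺ -/

section Modules

variable {S : Type u} [Ring S]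

/-- `N`, with the maps `φ i`, is the direct limit of the system `(G i, f i j)`. -/
structure IsDirLim {D : Type*} [Preorder D] {G : D → Type u} [∀ i, AddCommGroup (G i)]
    [∀ i, Module S (G i)] (f : ∀ i j, i ≤ j → G i →ₗ[S] G j) {N : Type u} [AddCommGroup N]
    [Module S N] (φ : ∀ i, G i →ₗ[S] N) : Prop where
  compat : ∀ i j h x, φ j (f i j h x) = φ i x
  surj : ∀ y, ∃ i x, φ i x = y
  zero : ∀ i x, φ i x = 0 → ∃ j h, f i j h x = 0

/-- The transition maps of a functor on a preorder. -/
def transition {D : Type u} [Preorder D] (F : D ⥤ ModuleCat.{u} S) (i j : D) (h : i ≤ j) :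
    F.obj i →ₗ[S] F.obj j :=
  (F.map (homOfLE h)).hom

/-- The maps of a cocone over a functor on a preorder. -/
def coconeMap {D : Type u} [Preorder D] (F : D ⥤ ModuleCat.{u} S) (c : Cocone F) (i : D) :
    F.obj i →ₗ[S] c.pt :=
  (c.ι.app i).hom

theorem isDirLim_of_isColimit {D : Type u} [PartialOrder D] [IsDirectedOrder D] [Nonempty D]
    (F : D ⥤ ModuleCat.{u} S) (c : Cocone F) (hc : IsColimit c) :
    IsDirLim (transition F) (coconeMap F c) := by
  refine ⟨fun i j h x => ?_, fun y => ?_, fun i x hx => ?_⟩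
  · exact ConcreteCategory.congr_hom (c.w (homOfLE h)) x
  · exact Concrete.isColimit_exists_rep F hc y
  · obtain ⟨k, f, g, h⟩ := Concrete.isColimit_exists_of_rep_eq F hc x (0 : F.obj i)
      (Eq.trans hx (map_zero (coconeMap F c i)).symm)
    refine ⟨k, leOfHom f, ?_⟩
    have h1 : (F.map f).hom x = 0 := by simpa using h
    exact h1

theorem nonempty_isColimit {D : Type u} [PartialOrder D] [IsDirectedOrder D] [Nonempty D]
    (F : D ⥤ ModuleCat.{u} S) (c : Cocone F)
    (h : IsDirLim (transition F) (coconeMap F c)) : Nonempty (IsColimit c) := by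
  refine ⟨isColimitOfReflects (forget (ModuleCat.{u} S)) (Types.FilteredColimit.isColimitOf _ _
    (fun y => ?_) fun i j x y hxy => ?_)⟩
  · obtain ⟨i, x, hx⟩ := h.surj y
    exact ⟨i, x, hx.symm⟩
  · change coconeMap F c i x = coconeMap F c j y at hxy
    obtain ⟨k, hik, hjk⟩ := exists_ge_ge i j
    have h1 : coconeMap F c k (transition F i k hik x - transition F j k hjk y) = 0 := by
      rw [map_sub, h.compat i k hik x, h.compat j k hjk y, hxy, sub_self]
    obtain ⟨l, hkl, hl⟩ := h.zero k _ h1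
    rw [map_sub, sub_eq_zero] at hl
    refine ⟨l, homOfLE (hik.trans hkl), homOfLE (hjk.trans hkl), ?_⟩
    have h2 : ∀ (i : D) (hik : i ≤ k) (x : F.obj i),
        (F.map (homOfLE (hik.trans hkl))).hom x = transition F k l hkl (transition F i k hik x) :=
      fun i hik x => by
        rw [← homOfLE_comp hik hkl, F.map_comp]; rfl
    exact (h2 i hik x).trans (hl.trans (h2 j hjk y).symm)

variable {A : ObjectProperty (ModuleCat.{u} S)} {ξ κ : Cardinal.{u}} {L : Type u} [AddCommGroup L]
  [Module S L]

/-- Let `L` be the union of a continuous chain of submodules generated by at most `κ` elements,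
indexed by `κ⁺`. If `L` is filtered by members of `A` with fewer than `ξ ≤ κ` generators and
relations, then some member of the chain with index in a given stationary set
has its quotient in `A`. -/
theorem PresentedFiltration.exists_quotient_mem {J : Type u} [LinearOrder J] [WellFoundedLT J]
    (P : PresentedFiltration A ξ L J) (hA : ClosedUnderFiltrations A) (hκ : ℵ₀ ≤ κ)
    (hξκ : ξ ≤ κ) {Gen : Ordinal.{u} → Set L} (hmono : Monotone Gen)
    (hcard : ∀ α < (Order.succ κ).ord, #(Gen α) ≤ κ)
    (hlim : ∀ α, Order.IsSuccLimit α → ∀ y ∈ Gen α, ∃ β < α, y ∈ Gen β)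
    (htop : ∀ y : L, ∃ α < (Order.succ κ).ord, y ∈ Submodule.span S (Gen α))
    {E : Set Ordinal.{u}} (hE : StationaryIn E (Order.succ κ).ord)
    (hElim : ∀ α ∈ E, Order.IsSuccLimit α) :
    ∃ α ∈ E, α < (Order.succ κ).ord ∧
      A (ModuleCat.of S (L ⧸ Submodule.span S (Gen α))) := by
  have hreg : (Order.succ κ).ord.cof = Order.succ κ := (isRegular_succ hκ).cof_ord
  have hspan : Monotone fun α => Submodule.span S (Gen α) := fun α β h => Submodule.span_mono (hmono h)
  -- Every y lies in the span of a closed set of at most κ indices. That span has at most κ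
  -- generators, so by regularity of κ⁺ it is contained in a single stage of the chain.
  have h1 : ∀ y : L, ∃ T : Set J, ∃ β, P.IsClosedSet T ∧ y ∈ P.spanned T ∧
      β < (Order.succ κ).ord ∧ P.spanned T ≤ Submodule.span S (Gen β) := fun y => by
    have hy : y ∈ P.spanned Set.univ := by
      have : P.spanned Set.univ = ⊤ := by simpa [spanned] using P.iSup_eq
      rw [this]; trivial
    obtain ⟨s, -, hs⟩ := P.exists_finset_of_mem_spanned hy
    obtain ⟨T, hsT, hT, hTc⟩ := P.exists_isClosedSet hκ hξκ (s : Set J)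
      ((lt_aleph0_of_finite _).le.trans hκ)
    obtain ⟨Z, hZ, hTZ⟩ := P.exists_spanned_eq_span hκ hξκ T hT
    choose l hl hl' using htop
    refine ⟨T, ⨆ z : Z, l z, hTc, P.spanned_mono hsT hs, ?_, ?_⟩
    · refine Ordinal.iSup_lt_of_lt_cof ?_ fun z => hl z
      rw [hreg]
      exact Order.lt_succ_of_le hZ
    · rw [hTZ, Submodule.span_le]
      intro z hz
      exact hspan (Ordinal.le_iSup (fun z : Z => l z) ⟨z, hz⟩) (hl' z)
  choose T h hTc hyT hh hTh using h1
  -- At a limit α closed under this function, the sets `T y` for y in `Gen α` together span exactly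
  -- the α-th stage: they capture its generators and never leave it.
  have hH : Monotone fun β => ⨆ y : Gen β, h y := fun β γ hβγ =>
    Ordinal.iSup_le fun y => Ordinal.le_iSup (fun y : Gen γ => h y) ⟨y, hmono hβγ y.2⟩
  obtain ⟨α, hαE, hα, hαH⟩ := hE.exists_closed_under (by
      rw [hreg]; exact Order.lt_succ_of_le hκ) hH fun β hβ => by
    refine Ordinal.iSup_lt_of_lt_cof ?_ fun y => hh y
    rw [hreg]
    exact Order.lt_succ_of_le (hcard β hβ)
  refine ⟨α, hαE, hα, ?_⟩
  have hcl : P.IsClosedSet (⋃ y : Gen α, T y) := IsClosedSet.iUnion P fun y => hTc y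
  have heq : P.spanned (⋃ y : Gen α, T y) = Submodule.span S (Gen α) := by
    rw [P.spanned_iUnion]
    refine le_antisymm (iSup_le fun y => ?_) (Submodule.span_le.2 fun y hy => ?_)
    · obtain ⟨β, hβ, hyβ⟩ := hlim α (hElim α hαE) y y.2
      refine (hTh y).trans (hspan ?_)
      exact (Ordinal.le_iSup (fun y : Gen β => h y) ⟨y, hyβ⟩).trans (hαH β hβ).le
    · exact (le_iSup (fun y : Gen α => P.spanned (T y)) ⟨y, hy⟩) (hyT y)
  rw [← heq]
  exact IsClosedSet.quotient_mem P hA hcl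

/-- The functor given by a chain of submodules. -/
def chainFunctor {I : Type u} [PartialOrder I] (N : I → Submodule S L) (h : Monotone N) :
    I ⥤ ModuleCat.{u} S where
  obj i := ModuleCat.of S (N i)
  map f := ModuleCat.ofHom (Submodule.inclusion (h (leOfHom f)))
  map_id _ := rfl
  map_comp _ _ := rfl

/-- Fewer than ξ ≤ κ indices have a supremum below κ⁺ by regularity, and the chain is continuous
there. So the chain is a system to which the closure hypothesis applies. -/
theorem mem_of_continuous_chain (hlim : ClosedUnderContinuousMonoWellOrderedLimits ξ A)
    (hκ : ℵ₀ ≤ κ) (hξκ : ξ ≤ κ) {N : Ordinal.{u} → Submodule S L} (hmono : Monotone N)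
    (hN : ∀ α < (Order.succ κ).ord, A (ModuleCat.of S (N α)))
    (hcont : ∀ α, Order.IsSuccLimit α → N α ≤ ⨆ β : Set.Iio α, N β)
    (htop : ∀ y : L, ∃ α < (Order.succ κ).ord, y ∈ N α) : A (ModuleCat.of S L) := by
  have hreg : (Order.succ κ).ord.cof = Order.succ κ := (isRegular_succ hκ).cof_ord
  let I := (Order.succ κ).ord.ToType
  let r : I → Ordinal.{u} := fun i => (Ordinal.ToType.mk.symm i : Ordinal.{u})
  have hr : ∀ i j, r i ≤ r j ↔ i ≤ j := fun i j => by simp [r]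
  have hrmono : Monotone fun i => N (r i) := fun i j h => hmono ((hr i j).2 h)
  have hI : Nonempty I := by
    rw [Ordinal.nonempty_toType_iff]
    exact (isRegular_succ hκ).ord_pos.ne'
  let c : Cocone (chainFunctor (fun i => N (r i)) hrmono) :=
    { pt := ModuleCat.of S L
      ι := { app := fun i => ModuleCat.ofHom (N (r i)).subtype
             naturality := fun _ _ _ => rfl } }
  refine hlim I (chainFunctor (fun i => N (r i)) hrmono) ?_ ?_ (fun i => hN _ ?_) c ?_
  · intro J hJ hJc hJξ
    have hJo : ⨆ j : J, r j < (Order.succ κ).ord := by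
      refine Ordinal.iSup_lt_of_lt_cof ?_ fun j => (Ordinal.ToType.mk.symm (j : I)).2
      rw [hreg]
      exact hJξ.trans_le (hξκ.trans (Order.le_succ κ))
    let s : I := Ordinal.ToType.mk ⟨⨆ j : J, r j, hJo⟩
    have hrs : r s = ⨆ j : J, r j := by simp [r, s]
    have hs : IsLUB J s := by
      constructor
      · intro j hj
        rw [← hr, hrs]
        exact Ordinal.le_iSup (fun j : J => r j) ⟨j, hj⟩
      · intro t ht
        rw [← hr, hrs]
        exact Ordinal.iSup_le fun j => (hr _ _).2 (ht j.2)
    refine ⟨s, hs, ?_⟩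
    have : Nonempty J := hJ.to_subtype
    have : IsDirectedOrder J := ⟨fun i j => by
      rcases hJc.total i.2 j.2 with h | h
      · exact ⟨j, h, le_rfl⟩
      · exact ⟨i, le_rfl, h⟩⟩
    refine nonempty_isColimit _ _ ⟨fun i j h x => rfl, ?_, ?_⟩
    · rintro ⟨y, hy⟩
      have h1 : N (r s) ≤ ⨆ j : J, N (r j) := by
        by_cases hmax : ∃ j : J, r j = r s
        · obtain ⟨j, hj⟩ := hmax
          rw [← hj]
          exact le_iSup (fun j : J => N (r j)) j
        · push Not at hmax
          have hlt : ∀ j : J, r j < r s := fun j =>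
            lt_of_le_of_ne ((hr _ _).2 (hs.1 j.2)) (hmax j)
          have hlimit : Order.IsSuccLimit (r s) := by
            rw [Ordinal.isSuccLimit_iff, Order.isSuccPrelimit_iff_succ_lt]
            refine ⟨?_, fun b hb => ?_⟩
            · obtain ⟨j⟩ := ‹Nonempty J›
              exact (bot_le.trans_lt (hlt j)).ne'
            · rw [hrs, Ordinal.lt_iSup_iff] at hb
              obtain ⟨j, hj⟩ := hb
              exact (Order.succ_le_of_lt hj).trans_lt (hlt j)
          refine (hcont _ hlimit).trans (iSup_le fun β => ?_)
          obtain ⟨j, hj⟩ := Ordinal.lt_iSup_iff.1 (lt_of_lt_of_eq β.2 hrs)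
          exact le_iSup_of_le j (hmono hj.le)
      have h2 := h1 hy
      rw [Submodule.mem_iSup_of_directed (fun j : J => N (r j))
        (Monotone.directed_le fun i j h => hrmono h)] at h2
      obtain ⟨j, hj⟩ := h2
      exact ⟨j, ⟨y, hj⟩, rfl⟩
    · rintro i ⟨x, hx⟩ h
      refine ⟨i, le_rfl, ?_⟩
      have : x = 0 := congrArg Subtype.val h
      subst this
      rfl
  · intro i j h
    exact Submodule.inclusion_injective (hrmono h)
  · exact (Ordinal.ToType.mk.symm i).2
  · refine nonempty_isColimit _ _ ⟨fun i j h x => rfl, ?_, ?_⟩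
    · intro y
      obtain ⟨α, hα, hy⟩ := htop y
      refine ⟨Ordinal.ToType.mk ⟨α, hα⟩, ⟨y, ?_⟩, rfl⟩
      simpa [r] using hy
    · rintro i ⟨x, hx⟩ h
      refine ⟨i, le_rfl, ?_⟩
      have : x = 0 := h
      subst this
      rfl

end Modules

/-- Ties within a rank are broken by an arbitrary well-order. This allows filtrations to be
described by ranks only. -/
theorem exists_wellOrder_of_rank {J : Type u} {Λ : Type u} [LinearOrder Λ] [WellFoundedLT Λ]
    (rk : J → Λ) : ∃ (_ : LinearOrder J) (_ : WellFoundedLT J),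
      (∀ i j, rk i < rk j → i < j) ∧ ∀ i j : J, i < j → rk i ≤ rk j := by
  let e : J → Ordinal.{u} := Ordinal.typein WellOrderingRel
  have he : Function.Injective e := Ordinal.typein_injective _
  let F : J → Λ ×ₗ Ordinal.{u} := fun j => toLex (rk j, e j)
  have hF : Function.Injective F := fun i j h => he (congrArg (fun p => (ofLex p).2) h)
  refine ⟨LinearOrder.lift' F hF, ⟨InvImage.wf F wellFounded_lt⟩, fun i j h => ?_, fun i j h => ?_⟩
  · exact Prod.Lex.lt_iff.2 (Or.inl h)
  · rcases Prod.Lex.lt_iff.1 (show F i < F j from h) with h | h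
    exacts [h.le, h.1.le]

/-! ### Filtrations given by ranks, and direct limits as quotients -/

section Modules

variable {S : Type u} [Ring S] {A : ObjectProperty (ModuleCat.{u} S)}

theorem isFactor_punit {L : Type u} [AddCommGroup L] [Module S L] {U W : Submodule S L}
    (h : W ≤ U) : IsFactor U W PUnit.{u + 1} :=
  ⟨0, fun x => ⟨0, rfl⟩, fun x => by simpa using h x.2⟩

theorem isFactor_quotient {L : Type u} [AddCommGroup L] [Module S L] (U W : Submodule S L) :
    IsFactor U W (W ⧸ U.submoduleOf W) :=
  ⟨Submodule.mkQ _, Submodule.mkQ_surjective _, fun _ =>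
    Submodule.Quotient.mk_eq_zero _⟩

theorem hasFiltration_submodule {L : Type u} [AddCommGroup L] [Module S L] {J : Type u}
    [LinearOrder J] [WellFoundedLT J] {W : J → Submodule S L} {N : Submodule S L}
    (hN : ⨆ j, W j = N)
    (hW : ∀ j, ∃ B : ModuleCat.{u} S, A B ∧ IsFactor (⨆ i < j, W i) (W j) B) :
    HasFiltration A N := by
  have hle : ∀ j, W j ≤ N := fun j => hN ▸ le_iSup W j
  have hmap : ∀ j, ((W j).comap N.subtype).map N.subtype = W j := fun j => by
    rw [Submodule.map_comap_subtype, inf_eq_right.2 (hle j)]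
  refine ⟨J, inferInstance, inferInstance, fun j => (W j).comap N.subtype, ?_, fun j => ?_⟩
  · apply Submodule.map_injective_of_injective N.injective_subtype
    rw [Submodule.map_iSup]
    simp only [hmap]
    rw [hN, Submodule.map_subtype_top]
  · obtain ⟨B, hB, q, hq, hq0⟩ := hW j
    refine ⟨B, hB, q ∘ₗ N.subtype.restrict (p := (W j).comap N.subtype) (q := W j)
      fun x hx => hx, hq.comp ?_, ?_⟩
    · rintro ⟨y, hy⟩
      exact ⟨⟨⟨y, hle j hy⟩, hy⟩, rfl⟩
    · rintro ⟨x, hx⟩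
      rw [LinearMap.comp_apply, hq0]
      have h1 : ⨆ i < j, W i = (⨆ i < j, (W i).comap N.subtype).map N.subtype := by
        simp only [Submodule.map_iSup, hmap]
      rw [h1]
      exact N.injective_subtype.mem_set_image

/-- A module generated by submodules `W j` of rank `rk j` belongs to `A` if the factor of `W j`
by anything between the sum of the `W i` of smaller rank and the sum of the other `W i` of
rank at most `rk j` is in `A`. -/
theorem ClosedUnderFiltrations.mem_of_rank (hA : ClosedUnderFiltrations A) {L : Type u}
    [AddCommGroup L] [Module S L] {J Λ : Type u} [LinearOrder Λ] [WellFoundedLT Λ] (rk : J → Λ)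
    {W : J → Submodule S L} {N : Submodule S L} (hN : ⨆ j, W j = N)
    (hW : ∀ j, ∀ U : Submodule S L, (∀ i, rk i < rk j → W i ≤ U) →
      (∀ U' : Submodule S L, (∀ i, i ≠ j → rk i ≤ rk j → W i ≤ U') → U ≤ U') →
      ∃ B : ModuleCat.{u} S, A B ∧ IsFactor U (W j) B) : A (ModuleCat.of S N) := by
  obtain ⟨_, _, h1, h2⟩ := exists_wellOrder_of_rank rk
  refine hA _ (hasFiltration_submodule hN fun j => hW j _ (fun i hi => ?_) fun U' hU' => ?_)
  · exact le_iSup₂_of_le (f := fun i (_ : i < j) => W i) i (h1 i j hi) le_rfl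
  · exact iSup₂_le fun i hi => hU' i hi.ne (h2 i j hi)

theorem ClosedUnderFiltrations.dfinsupp (hA : ClosedUnderFiltrations A) {ι : Type u}
    [LinearOrder ι] [WellFoundedLT ι] {G : ι → Type u} [∀ i, AddCommGroup (G i)]
    [∀ i, Module S (G i)] (hG : ∀ i, A (ModuleCat.of S (G i))) :
    A (ModuleCat.of S (Π₀ i, G i)) := by
  refine hA _ ⟨ι, inferInstance, inferInstance,
    fun i => LinearMap.range (DFinsupp.lsingle (R := S) i), DFinsupp.iSup_range_lsingle, fun j =>
    ⟨_, hG j, isFactor_range _ _ LinearMap.id Function.surjective_id fun x => ?_⟩⟩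
  constructor
  · rintro rfl
    simp
  · intro h
    have h1 : ⨆ i < j, LinearMap.range (DFinsupp.lsingle (R := S) (M := G) i) ≤
        LinearMap.ker (DFinsupp.lapply (R := S) (M := G) j) := by
      refine iSup₂_le fun i hi => ?_
      rintro _ ⟨y, rfl⟩
      simp [DFinsupp.single_eq_of_ne hi.ne']
    simpa using h1 h

/-- Modulo U the maps become compatible, so a sum of values collapses to a single value at a common
later index, and x dies only if it dies in the system. This identifies the limits occurring inside
tree modules, both as factors along short paths and as the quotient along a ladder. -/
theorem isDirLim_quotient {D : Type*} [Preorder D] [IsDirectedOrder D] [Nonempty D]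
    {G : D → Type u} [∀ i, AddCommGroup (G i)] [∀ i, Module S (G i)]
    (f : ∀ i j, i ≤ j → G i →ₗ[S] G j) {L : Type u} [AddCommGroup L] [Module S L]
    (φ : ∀ i, G i →ₗ[S] L) {W U : Submodule S L} (hφ : ∀ i x, φ i x ∈ W)
    (hcompat : ∀ i j h x, φ i x - φ j (f i j h x) ∈ U)
    (hsurj : ∀ y ∈ W, y ∈ (⨆ i, LinearMap.range (φ i)) ⊔ U)
    (hzero : ∀ i x, φ i x ∈ U → ∃ j h, f i j h x = 0) :
    IsDirLim f fun i => (U.submoduleOf W).mkQ ∘ₗ (φ i).codRestrict W (hφ i) := by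
  refine ⟨fun i j h x => ?_, fun y => ?_, fun i x hx => ?_⟩
  · rw [eq_comm]
    refine (Submodule.Quotient.eq _).2 ?_
    exact hcompat i j h x
  · obtain ⟨⟨y, hy⟩, rfl⟩ := Submodule.mkQ_surjective _ y
    have key : ∃ i x, y - φ i x ∈ U := by
      obtain ⟨y, hy', z, hz, rfl⟩ := Submodule.mem_sup.1 (hsurj y hy)
      have : ∃ i x, y - φ i x ∈ U := by
        refine Submodule.iSup_induction (fun i => LinearMap.range (φ i))
          (motive := fun y => ∃ i x, y - φ i x ∈ U) hy' ?_ ?_ ?_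
        · rintro i _ ⟨x, rfl⟩
          exact ⟨i, x, by simp⟩
        · exact ⟨Classical.arbitrary D, 0, by simp⟩
        · rintro y z ⟨i, x, hx⟩ ⟨j, w, hw⟩
          obtain ⟨k, hik, hjk⟩ := exists_ge_ge i j
          refine ⟨k, f i k hik x + f j k hjk w, ?_⟩
          have := U.add_mem (U.add_mem hx (hcompat i k hik x)) (U.add_mem hw (hcompat j k hjk w))
          rw [map_add]
          convert! this using 1
          abel
      obtain ⟨i, x, hx⟩ := this
      refine ⟨i, x, ?_⟩
      convert! U.add_mem hx hz using 1
      abel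
    obtain ⟨i, x, hx⟩ := key
    refine ⟨i, x, ?_⟩
    rw [eq_comm]
    exact (Submodule.Quotient.eq _).2 hx
  · exact hzero i x ((Submodule.Quotient.mk_eq_zero (U.submoduleOf W)).1 hx)

end Modules

/-! ### Tree modules and separated branches -/

section Tree

variable {S : Type u} [Ring S] {Θ V : Type u} [Inhabited V]

open Classical in
/-- The restriction of `t` to the indices in `s`, extended by the default value. -/
noncomputable def cut (s : Set Θ) (t : Θ → V) : Θ → V := fun μ => if μ ∈ s then t μ else default

theorem cut_of_mem {s : Set Θ} {t : Θ → V} {μ : Θ} (h : μ ∈ s) : cut s t μ = t μ := if_pos h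

theorem cut_of_notMem {s : Set Θ} {t : Θ → V} {μ : Θ} (h : μ ∉ s) : cut s t μ = default := if_neg h

theorem cut_eq_cut_iff {s : Set Θ} {t t' : Θ → V} : cut s t = cut s t' ↔ ∀ μ ∈ s, t μ = t' μ := by
  refine ⟨fun h μ hμ => ?_, fun h => ?_⟩
  · rw [← cut_of_mem (t := t) hμ, h, cut_of_mem hμ]
  · ext μ
    by_cases hμ : μ ∈ s
    · rw [cut_of_mem hμ, cut_of_mem hμ, h μ hμ]
    · rw [cut_of_notMem hμ, cut_of_notMem hμ]

variable [LinearOrder Θ] {G : Θ → Type u} [∀ i, AddCommGroup (G i)] [∀ i, Module S (G i)]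

open Classical in
/-- The embedding of `G a` along the path which consists of the initial segments of `t` of
successor length, from `a` up to `ℓ`. -/
noncomputable def path (f : ∀ i j, i ≤ j → G i →ₗ[S] G j) (t : Θ → V) (ℓ : WithTop Θ) (a : Θ) :
    G a →ₗ[S] ∀ c : Θ × (Θ → V), G c.1 :=
  LinearMap.pi fun c =>
    if h : a ≤ c.1 ∧ (c.1 : WithTop Θ) < ℓ ∧ c.2 = cut (Set.Iic c.1) t then f a c.1 h.1 else 0

variable (f : ∀ i j, i ≤ j → G i →ₗ[S] G j)

theorem path_apply_of_pos {t : Θ → V} {ℓ : WithTop Θ} {a : Θ} {c : Θ × (Θ → V)}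
    (h : a ≤ c.1) (h' : (c.1 : WithTop Θ) < ℓ ∧ c.2 = cut (Set.Iic c.1) t) (x : G a) :
    path f t ℓ a x c = f a c.1 h x := by
  have : a ≤ c.1 ∧ (c.1 : WithTop Θ) < ℓ ∧ c.2 = cut (Set.Iic c.1) t := ⟨h, h'⟩
  rw [path, LinearMap.pi_apply, dif_pos this]

theorem path_apply_of_neg {t : Θ → V} {ℓ : WithTop Θ} {a : Θ} {c : Θ × (Θ → V)}
    (h : ¬ (a ≤ c.1 ∧ (c.1 : WithTop Θ) < ℓ ∧ c.2 = cut (Set.Iic c.1) t)) (x : G a) :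
    path f t ℓ a x c = 0 := by
  rw [path, LinearMap.pi_apply, dif_neg h, LinearMap.zero_apply]

theorem path_apply_of {s t : Θ → V} {ℓ : WithTop Θ} {a c : Θ} (h : a ≤ c)
    (hc : (c : WithTop Θ) < ℓ) (hst : ∀ μ ≤ c, s μ = t μ) (x : G a) :
    path f t ℓ a x (c, cut (Set.Iic c) s) = f a c h x :=
  path_apply_of_pos f (c := (c, cut (Set.Iic c) s)) h ⟨hc, cut_eq_cut_iff.2 hst⟩ x

theorem path_apply_eq_zero {s t : Θ → V} {ℓ : WithTop Θ} {a c : Θ}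
    (h : c < a ∨ ℓ ≤ c ∨ ∃ μ ≤ c, s μ ≠ t μ) (x : G a) :
    path f t ℓ a x (c, cut (Set.Iic c) s) = 0 := by
  refine path_apply_of_neg f ?_ x
  rintro ⟨h1, h2, h3⟩
  rw [cut_eq_cut_iff] at h3
  rcases h with h | h | ⟨μ, hμ, h⟩
  · exact h1.not_gt h
  · exact h2.not_ge h
  · exact h (h3 μ hμ)

theorem path_congr {t t' : Θ → V} {ℓ : WithTop Θ} (h : ∀ μ : Θ, (μ : WithTop Θ) < ℓ → t μ = t' μ)
    (a : Θ) : path f t ℓ a = path f t' ℓ a := by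
  ext x c
  have hc : (c.1 : WithTop Θ) < ℓ → cut (Set.Iic c.1) t = cut (Set.Iic c.1) t' := fun hc =>
    cut_eq_cut_iff.2 fun μ hμ => h μ (lt_of_le_of_lt (WithTop.coe_le_coe.2 hμ) hc)
  by_cases h1 : a ≤ c.1 ∧ (c.1 : WithTop Θ) < ℓ ∧ c.2 = cut (Set.Iic c.1) t
  · rw [path_apply_of_pos f h1.1 h1.2, path_apply_of_pos f h1.1 ⟨h1.2.1, h1.2.2.trans (hc h1.2.1)⟩]
  · rw [path_apply_of_neg f h1, path_apply_of_neg f fun h2 =>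
      h1 ⟨h2.1, h2.2.1, h2.2.2.trans (hc h2.2.1).symm⟩]

/-- The coordinates at levels in [a, b) and in [b, ℓ) are treated separately. Modulo the short path
up to b, the elements x at a and `f a b hab x` at b give the same path, which is the defining
relation of the direct limit. -/
theorem path_split (hf : ∀ i j k hij hjk x, f j k hjk (f i j hij x) = f i k (hij.trans hjk) x)
    (t : Θ → V) {ℓ : WithTop Θ} {a b : Θ} (hab : a ≤ b) (hb : (b : WithTop Θ) ≤ ℓ) (x : G a) :
    path f t ℓ a x = path f t b a x + path f t ℓ b (f a b hab x) := by
  ext c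
  rw [Pi.add_apply]
  rcases lt_or_ge c.1 b with h | h
  · rw [path_apply_of_neg f (fun h' => h'.1.not_gt h) (f a b hab x), add_zero]
    by_cases h1 : a ≤ c.1 ∧ c.2 = cut (Set.Iic c.1) t
    · rw [path_apply_of_pos f h1.1 ⟨(WithTop.coe_lt_coe.2 h).trans_le hb, h1.2⟩,
        path_apply_of_pos f h1.1 ⟨WithTop.coe_lt_coe.2 h, h1.2⟩]
    · rw [path_apply_of_neg f fun h2 => h1 ⟨h2.1, h2.2.2⟩,
        path_apply_of_neg f fun h2 => h1 ⟨h2.1, h2.2.2⟩]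
  · rw [path_apply_of_neg f (ℓ := b) (fun h' => (WithTop.coe_lt_coe.1 h'.2.1).not_ge h) x, zero_add]
    by_cases h1 : (c.1 : WithTop Θ) < ℓ ∧ c.2 = cut (Set.Iic c.1) t
    · rw [path_apply_of_pos f (hab.trans h) h1, path_apply_of_pos f h h1, hf]
    · rw [path_apply_of_neg f fun h2 => h1 h2.2, path_apply_of_neg f fun h2 => h1 h2.2]

/-- The generators of the tree module: paths along the members of `Sh`, which are pairs consisting
of a length and a sequence, and paths along the branches `η δ`. -/
def pathGens {Δ : Type*} (Sh : Set (Θ × (Θ → V))) (η : Δ → Θ → V) :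
    Set (∀ c : Θ × (Θ → V), G c.1) :=
  {y | (∃ p ∈ Sh, ∃ a < p.1, ∃ x, path f p.2 p.1 a x = y) ∨ ∃ δ a x, path f (η δ) ⊤ a x = y}

end Tree

section Tree

variable {S : Type u} [Ring S] {Θ V : Type u} [Inhabited V] [LinearOrder Θ]
  {G : Θ → Type u} [∀ i, AddCommGroup (G i)] [∀ i, Module S (G i)]

/-- The elements which vanish along `t` from some point before `ℓ` on. -/
def eventuallyVanishing (S : Type u) [Ring S] (G : Θ → Type u) [∀ i, AddCommGroup (G i)]
    [∀ i, Module S (G i)] (t : Θ → V) (ℓ : WithTop Θ) (hℓ : ∃ b : Θ, (b : WithTop Θ) < ℓ) :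
    Submodule S (∀ c : Θ × (Θ → V), G c.1) where
  carrier := {y | ∃ b : Θ, (b : WithTop Θ) < ℓ ∧
    ∀ c, b ≤ c → (c : WithTop Θ) < ℓ → y (c, cut (Set.Iic c) t) = 0}
  zero_mem' := by
    obtain ⟨b, hb⟩ := hℓ
    exact ⟨b, hb, fun c _ _ => rfl⟩
  add_mem' := by
    rintro x y ⟨b, hb, hx⟩ ⟨b', hb', hy⟩
    refine ⟨max b b', ?_, fun c hc hcℓ => ?_⟩
    · rcases max_choice b b' with h | h <;> rw [h] <;> assumption
    · rw [Pi.add_apply, hx c ((le_max_left _ _).trans hc) hcℓ,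
        hy c ((le_max_right _ _).trans hc) hcℓ, add_zero]
  smul_mem' := by
    rintro s x ⟨b, hb, hx⟩
    refine ⟨b, hb, fun c hc hcℓ => ?_⟩
    rw [Pi.smul_apply, hx c hc hcℓ, smul_zero]

/-- The elements which vanish along `t` from `b` on. -/
def vanishingFrom (S : Type u) [Ring S] (G : Θ → Type u) [∀ i, AddCommGroup (G i)]
    [∀ i, Module S (G i)] (t : Θ → V) (b : Θ) : Submodule S (∀ c : Θ × (Θ → V), G c.1) where
  carrier := {y | ∀ c, b ≤ c → y (c, cut (Set.Iic c) t) = 0}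
  zero_mem' := fun c _ => rfl
  add_mem' := fun hx hy c hc => by rw [Pi.add_apply, hx c hc, hy c hc, add_zero]
  smul_mem' := fun s x hx c hc => by rw [Pi.smul_apply, hx c hc, smul_zero]

variable (f : ∀ i j, i ≤ j → G i →ₗ[S] G j)

/-- The coordinates of the path are the images of x under the transition maps, so one vanishing
coordinate above a already kills x in the system. -/
theorem path_zero_of_mem_eventuallyVanishing {t : Θ → V} {ℓ : WithTop Θ}
    {hℓ : ∃ b : Θ, (b : WithTop Θ) < ℓ} {a : Θ} (ha : (a : WithTop Θ) < ℓ) {x : G a}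
    (h : path f t ℓ a x ∈ eventuallyVanishing S G t ℓ hℓ) :
    ∃ b, ∃ hab : a ≤ b, (b : WithTop Θ) < ℓ ∧ f a b hab x = 0 := by
  obtain ⟨b, hb, h⟩ := h
  have hmax : ((max a b : Θ) : WithTop Θ) < ℓ := by
    rcases max_choice a b with h | h <;> rw [h] <;> assumption
  refine ⟨max a b, le_max_left _ _, hmax, ?_⟩
  rw [← h _ (le_max_right _ _) hmax, path_apply_of f (le_max_left _ _) hmax fun _ _ => rfl]

/-- Three ways for the second path to have no node on t near ℓ: it starts too late, it has ended by
level b, or it has split off at b. -/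
theorem range_path_le_eventuallyVanishing {t t' : Θ → V} {ℓ ℓ' : WithTop Θ}
    (hℓ : ∃ b : Θ, (b : WithTop Θ) < ℓ) {a : Θ}
    (h : ∃ b : Θ, (b : WithTop Θ) < ℓ ∧ (ℓ ≤ a ∨ ℓ' ≤ b ∨ t b ≠ t' b)) :
    LinearMap.range (path f t' ℓ' a) ≤ eventuallyVanishing S G t ℓ hℓ := by
  rintro _ ⟨x, rfl⟩
  obtain ⟨b, hb, h⟩ := h
  refine ⟨b, hb, fun c hc hcℓ => path_apply_eq_zero f ?_ x⟩
  rcases h with h | h | h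
  · exact Or.inl (WithTop.coe_lt_coe.1 (hcℓ.trans_le h))
  · exact Or.inr (Or.inl (h.trans (WithTop.coe_le_coe.2 hc)))
  · exact Or.inr (Or.inr ⟨b, hc, h⟩)

variable [WellFoundedLT Θ] {A : ObjectProperty (ModuleCat.{u} S)}

/-- A tree module belongs to `A` if its branches can be separated by removing proper initial
segments. -/
theorem ClosedUnderFiltrations.pathGens_mem (hA : ClosedUnderFiltrations A)
    (hid : ∀ i x, f i i le_rfl x = x)
    (hf : ∀ i j k hij hjk x, f j k hjk (f i j hij x) = f i k (hij.trans hjk) x)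
    (hG : ∀ a, A (ModuleCat.of S (G a)))
    (hdl : ∀ b : Θ, (Set.Iio b).Nonempty → ∀ (N : Type u) [AddCommGroup N] [Module S N]
      (φ : ∀ i : Set.Iio b, G i →ₗ[S] N),
      IsDirLim (fun (i j : Set.Iio b) (h : i ≤ j) => f i j h) φ → A (ModuleCat.of S N))
    {Δ : Type u} {Sh : Set (Θ × (Θ → V))} {η : Δ → Θ → V}
    (hSh : ∀ p ∈ Sh, ∀ μ, p.1 ≤ μ → p.2 μ = default)
    (hcl : ∀ p ∈ Sh, ∀ b < p.1, (b, cut (Set.Iio b) p.2) ∈ Sh)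
    (hη : ∀ δ b, (b, cut (Set.Iio b) (η δ)) ∈ Sh) (g : Δ → Θ)
    (hsep : ∀ δ δ', δ ≠ δ' → ∀ ν, g δ ≤ ν → g δ' ≤ ν → ∃ μ ≤ ν, η δ μ ≠ η δ' μ) :
    A (ModuleCat.of S (Submodule.span S (pathGens f Sh η))) := by
  classical
  -- A short path has its length as rank, a branch its separation level `g δ`. Only the tail of a
  -- branch from `g δ` on is used; the rest is covered by the short path of length `g δ`.
  let Wp : Θ × (Θ → V) → Submodule S (∀ c : Θ × (Θ → V), G c.1) := fun p =>
    ⨆ a : Set.Iio p.1, LinearMap.range (path f p.2 p.1 a)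
  let Wb : Δ → Submodule S (∀ c : Θ × (Θ → V), G c.1) := fun δ =>
    ⨆ a : Set.Ici (g δ), LinearMap.range (path f (η δ) ⊤ a)
  let W : Sh ⊕ Δ → Submodule S (∀ c : Θ × (Θ → V), G c.1) := Sum.elim (fun p => Wp p) Wb
  let rk : Sh ⊕ Δ → Θ := Sum.elim (fun p => p.1.1) g
  have hWp : ∀ p : Θ × (Θ → V), ∀ a < p.1, ∀ x, path f p.2 p.1 a x ∈ Wp p := fun p a ha x =>
    (le_iSup (fun a : Set.Iio p.1 => LinearMap.range (path f p.2 p.1 a)) ⟨a, ha⟩) ⟨x, rfl⟩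
  have hWb : ∀ δ, ∀ a, g δ ≤ a → ∀ x, path f (η δ) ⊤ a x ∈ Wb δ := fun δ a ha x =>
    (le_iSup (fun a : Set.Ici (g δ) => LinearMap.range (path f (η δ) ⊤ a)) ⟨a, ha⟩) ⟨x, rfl⟩
  have hcut : ∀ (t : Θ → V) (b a : Θ), path f (cut (Set.Iio b) t) b a = path f t b a :=
    fun t b a => path_congr f (fun μ hμ => cut_of_mem (s := Set.Iio b) (WithTop.coe_lt_coe.1 hμ)) a
  have hWc : ∀ (t : Θ → V) (b a : Θ), a < b → ∀ x, path f t b a x ∈ Wp (b, cut (Set.Iio b) t) :=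
    fun t b a hab x => by
      rw [← hcut]
      exact hWp (b, cut (Set.Iio b) t) a hab x
  have htop : ∀ (b : Θ), (b : WithTop Θ) ≤ ⊤ := fun b => le_top
  refine hA.mem_of_rank rk (W := W) ?_ ?_
  · refine le_antisymm (iSup_le ?_) (Submodule.span_le.2 ?_)
    · rintro (p | δ)
      · refine iSup_le fun a => ?_
        rintro _ ⟨x, rfl⟩
        exact Submodule.subset_span (Or.inl ⟨p, p.2, a, a.2, x, rfl⟩)
      · refine iSup_le fun a => ?_
        rintro _ ⟨x, rfl⟩
        exact Submodule.subset_span (Or.inr ⟨δ, a, x, rfl⟩)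
    · rintro y (⟨p, hp, a, ha, x, rfl⟩ | ⟨δ, a, x, rfl⟩)
      · exact (le_iSup W (Sum.inl ⟨p, hp⟩)) (hWp p a ha x)
      · rcases le_or_gt (g δ) a with h | h
        · exact (le_iSup W (Sum.inr δ)) (hWb δ a h x)
        · rw [path_split f hf (η δ) h.le (htop _)]
          exact Submodule.add_mem _
            ((le_iSup W (Sum.inl ⟨_, hη δ (g δ)⟩)) (hWc (η δ) (g δ) a h x))
            ((le_iSup W (Sum.inr δ)) (hWb δ (g δ) le_rfl _))
  · rintro (⟨⟨ℓ, t⟩, hp⟩ | δ) U hU1 hU2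
    · change ∃ B : ModuleCat.{u} S, A B ∧ IsFactor U (Wp (ℓ, t)) B
      by_cases hon : ∃ δ, g δ < ℓ ∧ ∀ μ < ℓ, t μ = η δ μ
      · obtain ⟨δ, hδ, ht⟩ := hon
        refine ⟨_, hA.of_subsingleton PUnit, isFactor_punit (iSup_le fun a => ?_)⟩
        rintro _ ⟨x, rfl⟩
        have hbU : ∀ a, g δ ≤ a → ∀ x, path f (η δ) ⊤ a x ∈ U := fun a ha x =>
          hU1 (Sum.inr δ) hδ (hWb δ a ha x)
        have hlong : ∀ a, g δ ≤ a → a < ℓ → ∀ x, path f (η δ) ℓ a x ∈ U := fun a ha haℓ x => by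
          have h1 := path_split f hf (η δ) haℓ.le (htop ℓ) x
          rw [← sub_eq_iff_eq_add] at h1
          rw [← h1]
          exact U.sub_mem (hbU a ha x) (hbU ℓ hδ.le _)
        have h2 : path f t ℓ a = path f (η δ) ℓ a :=
          path_congr f (fun μ hμ => ht μ (WithTop.coe_lt_coe.1 hμ)) a
        change path f t ℓ a x ∈ U
        rw [h2]
        rcases le_or_gt (g δ) a with h | h
        · exact hlong a h a.2 x
        · rw [path_split f hf (η δ) h.le (WithTop.coe_le_coe.2 hδ.le)]
          exact U.add_mem (hU1 (Sum.inl ⟨_, hη δ (g δ)⟩) hδ (hWc (η δ) (g δ) a h x))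
            (hlong _ le_rfl hδ _)
      · push Not at hon
        rcases (Set.Iio ℓ).eq_empty_or_nonempty with hemp | hne
        · refine ⟨_, hA.of_subsingleton PUnit, isFactor_punit (iSup_le fun a => ?_)⟩
          exact absurd (show (a : Θ) ∈ Set.Iio ℓ from a.2) (Set.eq_empty_iff_forall_notMem.1 hemp a)
        · have hℓ : ∃ b : Θ, (b : WithTop Θ) < (ℓ : WithTop Θ) := by
            obtain ⟨b, hb⟩ := hne
            exact ⟨b, WithTop.coe_lt_coe.2 hb⟩
          -- Everything else of rank at most ℓ misses t near ℓ: shorter paths end, other paths of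
          -- length ℓ differ from t before ℓ, branches with `g δ` < ℓ have left t by the failure of
          -- `hon`, and tails with `g δ` = ℓ start too late. Hence the factor is the limit of the
          -- G_a with a < ℓ.
          have hUV : U ≤ eventuallyVanishing S G t ℓ hℓ := by
            refine hU2 _ ?_
            rintro (⟨⟨ℓ', t'⟩, hp'⟩ | δ) hne' hrk
            · refine iSup_le fun a => range_path_le_eventuallyVanishing f hℓ ?_
              rcases lt_or_eq_of_le (show ℓ' ≤ ℓ from hrk) with h | h
              · exact ⟨ℓ', WithTop.coe_lt_coe.2 h, Or.inr (Or.inl le_rfl)⟩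
              · subst h
                have htt : t ≠ t' := fun h => hne' (by subst h; rfl)
                obtain ⟨μ, hμ⟩ := Function.ne_iff.1 htt
                have hμℓ : μ < ℓ' := by
                  by_contra hμℓ
                  rw [not_lt] at hμℓ
                  exact hμ ((hSh _ hp μ hμℓ).trans (hSh _ hp' μ hμℓ).symm)
                exact ⟨μ, WithTop.coe_lt_coe.2 hμℓ, Or.inr (Or.inr hμ)⟩
            · refine iSup_le fun a => range_path_le_eventuallyVanishing f hℓ ?_
              rcases lt_or_eq_of_le (show g δ ≤ ℓ from hrk) with h | h
              · obtain ⟨μ, hμ, hμ'⟩ := hon δ h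
                exact ⟨μ, WithTop.coe_lt_coe.2 hμ, Or.inr (Or.inr hμ')⟩
              · obtain ⟨b, hb⟩ := hℓ
                exact ⟨b, hb, Or.inl (WithTop.coe_le_coe.2 (h.symm.le.trans a.2))⟩
          have : Nonempty (Set.Iio ℓ) := hne.to_subtype
          refine ⟨_, hdl ℓ hne _ _ (isDirLim_quotient (fun (i j : Set.Iio ℓ) (h : i ≤ j) => f i j h)
            (fun a : Set.Iio ℓ => path f t ℓ a) (W := Wp (ℓ, t)) (U := U)
            (fun a x => hWp (ℓ, t) a a.2 x) ?_ ?_ ?_), isFactor_quotient U (Wp (ℓ, t))⟩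
          · intro i j h x
            rw [path_split f hf t (b := j) h (WithTop.coe_le_coe.2 (le_of_lt j.2)),
              add_sub_cancel_right]
            rcases eq_or_lt_of_le h with h | h
            · subst h
              have : path f t (i : Θ) i x = 0 := by
                ext c
                exact path_apply_of_neg f (fun h =>
                  (WithTop.coe_lt_coe.1 h.2.1).not_ge h.1) x
              rw [this]
              exact U.zero_mem
            · exact hU1 (Sum.inl ⟨_, hcl _ hp j j.2⟩) j.2 (hWc t j i h x)
          · intro y hy
            exact Submodule.mem_sup_left hy
          · intro i x hx
            obtain ⟨b, hab, hb, h0⟩ := path_zero_of_mem_eventuallyVanishing f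
              (WithTop.coe_lt_coe.2 i.2) (hUV hx)
            exact ⟨⟨b, WithTop.coe_lt_coe.1 hb⟩, hab, h0⟩
    · change ∃ B : ModuleCat.{u} S, A B ∧ IsFactor U (Wb δ) B
      -- From level `g δ` on, `η δ` meets neither the short paths of rank at most `g δ` nor the
      -- other branches of such rank. A nonzero finite family is then detected at its least index,
      -- where the coordinate on `η δ` is the entry itself; so the factor is the direct sum of the
      -- G_a, a ≥ `g δ`.
      have hUV : U ≤ vanishingFrom S G (η δ) (g δ) := by
        refine hU2 _ ?_
        rintro (⟨⟨ℓ', t'⟩, hp'⟩ | δ') hne' hrk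
        · refine iSup_le fun a => ?_
          rintro _ ⟨x, rfl⟩ c hc
          exact path_apply_eq_zero f (Or.inr (Or.inl (WithTop.coe_le_coe.2
            ((show ℓ' ≤ g δ from hrk).trans hc)))) x
        · refine iSup_le fun a => ?_
          rintro _ ⟨x, rfl⟩ c hc
          exact path_apply_eq_zero f (Or.inr (Or.inr
            (hsep δ δ' (fun h => hne' (by rw [h])) c hc ((show g δ' ≤ g δ from hrk).trans hc)))) x
      let p : (Π₀ a : Set.Ici (g δ), G a) →ₗ[S] (∀ c : Θ × (Θ → V), G c.1) :=
        DFinsupp.lsum ℕ fun a : Set.Ici (g δ) => path f (η δ) ⊤ a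
      have hp : Wb δ = LinearMap.range p := by
        refine le_antisymm (iSup_le fun a => ?_) ?_
        · rintro _ ⟨x, rfl⟩
          exact ⟨DFinsupp.single a x, by simp [p]⟩
        · rintro _ ⟨x, rfl⟩
          rw [DFinsupp.lsum_apply_apply, DFinsupp.sumAddHom_apply]
          exact Submodule.sum_mem _ fun a _ => hWb δ a a.2 _
      rw [hp]
      refine ⟨_, hA.dfinsupp fun a : Set.Ici (g δ) => hG a, isFactor_range U p LinearMap.id
        Function.surjective_id fun x => ⟨?_, fun hx => ?_⟩⟩
      · rintro rfl
        rw [map_zero]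
        exact U.zero_mem
      · have hx' := hUV hx
        by_contra hx0
        obtain ⟨a, ha, hmin⟩ := WellFounded.has_min (wellFounded_lt (α := Set.Ici (g δ)))
          {a | x a ≠ 0} (by
            by_contra h
            rw [Set.not_nonempty_iff_eq_empty] at h
            refine hx0 (DFinsupp.ext fun a => ?_)
            by_contra h'
            exact (h ▸ h' : a ∈ (∅ : Set (Set.Ici (g δ)))))
        have h1 := hx' a a.2
        rw [DFinsupp.lsum_apply_apply, DFinsupp.sumAddHom_apply, DFinsupp.sum,
          Finset.sum_apply, Finset.sum_eq_single a] at h1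
        · refine ha ?_
          rw [← h1]
          exact ((path_apply_of f le_rfl (WithTop.coe_lt_top _) (fun _ _ => rfl) (x a)).trans
            (hid _ _)).symm
        · intro b hb hba
          rcases lt_or_gt_of_ne hba with h | h
          · exact absurd h (hmin b (by simpa using hb))
          · exact path_apply_eq_zero f (Or.inl h) _
        · intro h
          have : x a = 0 := by simpa using h
          rw [this]
          simp

end Tree

/-! ### Ladders and non-reflection -/

theorem mk_Iio_lt_of_toType {c : Cardinal.{u}} (i : c.ord.ToType) : #(Set.Iio i) < c := by
  simpa using mk_Iio_lt i (by simp)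

/-- An ordinal of cofinality `θ` has a monotone cofinal sequence of length `θ`. -/
theorem exists_monotone_cofinal {θ : Cardinal.{u}} {δ : Ordinal.{u}} (h : δ.cof = θ) :
    ∃ η : θ.ord.ToType → Ordinal.{u}, Monotone η ∧ (∀ a, η a < δ) ∧ ∀ β < δ, ∃ a, β ≤ η a := by
  obtain ⟨s, hs⟩ := Ordinal.exists_isFundamentalSeq (o := δ) (a := θ.ord) (by rw [h])
  refine ⟨fun a => s (Ordinal.ToType.mk.symm a), fun a b hab => ?_, fun a => (s _).2,
    fun β hβ => ?_⟩
  · exact hs.strictMono.monotone (Ordinal.ToType.mk.symm.monotone hab)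
  · obtain ⟨_, ⟨a, rfl⟩, ha⟩ := hs.isCofinal_range ⟨β, hβ⟩
    exact ⟨Ordinal.ToType.mk a, by
      beta_reduce
      rw [OrderIso.symm_apply_apply]
      exact ha⟩

/-- A limit ordinal in which `E` is not stationary if the cofinality is uncountable has a cofinal
subset which does not accumulate at members of `E`. -/
theorem exists_cofinal_not_accumulating {E : Set Ordinal.{u}} (hE : ∀ δ ∈ E, Order.IsSuccLimit δ)
    {α : Ordinal.{u}} (hα : Order.IsSuccLimit α) (hst : ℵ₀ < α.cof → ¬ StationaryIn E α) :
    ∃ C : Set Ordinal.{u}, (∀ x ∈ C, x < α) ∧ (∀ β < α, ∃ x ∈ C, β ≤ x) ∧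
      ∀ δ ∈ E, δ < α → ∃ c < δ, ∀ x ∈ C, x < δ → x ≤ c := by
  have h0 : ℵ₀ ≤ α.cof := by
    by_contra h
    exact absurd (Ordinal.one_lt_cof_iff.2 hα) (not_lt.2 (Ordinal.cof_lt_aleph0_iff.1 (not_le.1 h)))
  rcases eq_or_lt_of_le h0 with h | h
  -- Countable cofinality: only finitely many terms of a cofinal ω-sequence lie below δ.
  · obtain ⟨η, hη, hηα, hηc⟩ := exists_monotone_cofinal h.symm
    refine ⟨Set.range η, ?_, ?_, fun δ hδ hδα => ?_⟩
    · rintro _ ⟨a, rfl⟩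
      exact hηα a
    · intro β hβ
      obtain ⟨a, ha⟩ := hηc β hβ
      exact ⟨_, ⟨a, rfl⟩, ha⟩
    · obtain ⟨a, ha⟩ := hηc δ hδα
      have hfin : (Set.Iio a).Finite := lt_aleph0_iff_set_finite.1 (mk_Iio_lt_of_toType a)
      have key : ∀ s : Set Ordinal.{u}, s.Finite → (∀ x ∈ s, x < δ) → ∃ c < δ, ∀ x ∈ s, x ≤ c := by
        intro s hs
        induction s, hs using Set.Finite.induction_on with
        | empty => exact fun _ => ⟨0, (hE δ hδ).bot_lt, by simp⟩
        | @insert x s _ _ ih =>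
          intro h
          obtain ⟨c, hc, hc'⟩ := ih fun y hy => h y (Set.mem_insert_of_mem _ hy)
          refine ⟨max x c, max_lt (h x (Set.mem_insert _ _)) hc, ?_⟩
          rintro y (rfl | hy)
          · exact le_max_left _ _
          · exact (hc' y hy).trans (le_max_right _ _)
      obtain ⟨c, hc, hc'⟩ := key ({x | x < δ} ∩ η '' Set.Iio a)
        ((hfin.image η).subset Set.inter_subset_right) fun x hx => hx.1
      refine ⟨c, hc, ?_⟩
      rintro _ ⟨b, rfl⟩ hb
      refine hc' _ ⟨hb, b, ?_, rfl⟩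
      by_contra hab
      exact (ha.trans (hη (not_lt.1 hab))).not_gt hb
  -- Uncountable cofinality: a club disjoint from E contains its accumulation points, so none of
  -- them is in E.
  · obtain ⟨t, ht, hdisj⟩ := not_isStationary_iff.1 (hst h)
    refine ⟨Subtype.val '' t, ?_, ?_, fun δ hδ hδα => ?_⟩
    · rintro _ ⟨x, -, rfl⟩
      exact x.2
    · intro β hβ
      obtain ⟨x, hx, hβx⟩ := ht.isCofinal ⟨β, hβ⟩
      exact ⟨x, ⟨x, hx, rfl⟩, hβx⟩
    · by_contra! hcon
      refine Set.disjoint_left.1 hdisj (show (⟨δ, hδα⟩ : Set.Iio α) ∈ _ from hδ) ?_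
      refine ht.dirSupClosed (d := {x | x ∈ t ∧ (x : Ordinal.{u}) < δ}) (fun x hx => hx.1) ?_ ?_ ?_
      · obtain ⟨_, ⟨x, hx, rfl⟩, hxδ, -⟩ := hcon 0 (hE δ hδ).bot_lt
        exact ⟨x, hx, hxδ⟩
      · exact fun x hx y hy => (le_total x y).elim (fun h => ⟨y, hy, h, le_rfl⟩)
          fun h => ⟨x, hx, le_rfl, h⟩
      · refine ⟨fun x hx => (show (x : Ordinal.{u}) ≤ δ from hx.2.le), fun b hb => ?_⟩
        by_contra hbδ
        obtain ⟨_, ⟨x, hx, rfl⟩, hxδ, hbx⟩ := hcon b (not_le.1 hbδ)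
        exact (show (x : Ordinal.{u}) ≤ b from hb ⟨hx, hxδ⟩).not_gt hbx

/-- The ladders of the members of a non-reflecting set below an ordinal `α < κ⁺` can be separated by
removing proper initial segments. -/
theorem IsNonreflectingStationary.exists_separation {κ : Cardinal.{u}} {E : Set Ordinal.{u}}
    (hE : IsNonreflectingStationary κ E) (hlim : ∀ δ ∈ E, Order.IsSuccLimit δ) {Θ : Type u}
    [LinearOrder Θ] [Nonempty Θ] {η : Ordinal.{u} → Θ → Ordinal.{u}}
    (hlt : ∀ δ ∈ E, ∀ a, η δ a < δ) (hcof : ∀ δ ∈ E, ∀ β < δ, ∃ a, β ≤ η δ a)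
    {α : Ordinal.{u}} (hα : α < (Order.succ κ).ord) :
    ∃ g : Ordinal.{u} → Θ, ∀ δ ∈ E, ∀ δ' ∈ E, δ < α → δ' < α → δ ≠ δ' →
      ∀ ν, g δ ≤ ν → g δ' ≤ ν → ∃ μ ≤ ν, η δ μ ≠ η δ' μ := by
  suffices h : ∃ g : Ordinal.{u} → Θ, ∀ δ ∈ E, ∀ δ' ∈ E, δ < δ' → δ' < α →
      ∀ ν, g δ ≤ ν → g δ' ≤ ν → ∃ μ ≤ ν, η δ μ ≠ η δ' μ by
    obtain ⟨g, hg⟩ := h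
    refine ⟨g, fun δ hδ δ' hδ' hδα hδα' hne ν h1 h2 => ?_⟩
    rcases lt_or_gt_of_ne hne with h | h
    · exact hg δ hδ δ' hδ' h hδα' ν h1 h2
    · obtain ⟨μ, hμ, h3⟩ := hg δ' hδ' δ hδ h hδα ν h2 h1
      exact ⟨μ, hμ, h3.symm⟩
  have hcof' : ∀ δ β, ∃ a, δ ∈ E → β < δ → β ≤ η δ a := fun δ β => by
    by_cases h : δ ∈ E ∧ β < δ
    · obtain ⟨a, ha⟩ := hcof δ h.1 β h.2
      exact ⟨a, fun _ _ => ha⟩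
    · exact ⟨Classical.arbitrary Θ, fun h1 h2 => absurd ⟨h1, h2⟩ h⟩
  choose lev hlev using hcof'
  induction α using WellFoundedLT.induction with
  | ind α ih =>
    rcases Ordinal.zero_or_succ_or_isSuccLimit α with rfl | ⟨β, rfl⟩ | hαlim
    · exact ⟨fun _ => Classical.arbitrary Θ, fun δ _ δ' _ _ h => absurd h not_lt_zero⟩
    · obtain ⟨g, hg⟩ := ih β (Order.lt_succ β) ((Order.lt_succ β).trans hα)
      -- Only the ladder of β is new. At level `a₀ δ` it has reached δ, while the ladder of δ stays
      -- below δ.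
      let a₀ : Ordinal.{u} → Θ := fun δ => lev β δ
      refine ⟨fun δ => max (g δ) (a₀ δ), fun δ hδ δ' hδ' hlt' hδβ ν h1 h2 => ?_⟩
      rcases lt_or_eq_of_le (Order.lt_succ_iff.1 hδβ) with h | rfl
      · exact hg δ hδ δ' hδ' hlt' h ν ((le_max_left _ _).trans h1) ((le_max_left _ _).trans h2)
      · refine ⟨a₀ δ, (le_max_right _ _).trans h1, ne_of_lt ?_⟩
        exact (hlt δ hδ _).trans_le (hlev δ' δ hδ' hlt')
    · obtain ⟨C, hCα, hCc, hCE⟩ := exists_cofinal_not_accumulating hlim hαlim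
        (hE.nonreflecting α hα)
      have hCE' : ∀ δ, ∃ c, δ ∈ E → δ < α → c < δ ∧ ∀ x ∈ C, x < δ → x ≤ c := fun δ => by
        by_cases h : δ ∈ E ∧ δ < α
        · obtain ⟨c, hc, hc'⟩ := hCE δ h.1 h.2
          exact ⟨c, fun _ _ => ⟨hc, hc'⟩⟩
        · exact ⟨0, fun h1 h2 => absurd ⟨h1, h2⟩ h⟩
      choose c hc using hCE'
      have ih' : ∀ x, ∃ g : Ordinal.{u} → Θ, x ∈ C → ∀ δ ∈ E, ∀ δ' ∈ E, δ < δ' → δ' ≤ x →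
          ∀ ν, g δ ≤ ν → g δ' ≤ ν → ∃ μ ≤ ν, η δ μ ≠ η δ' μ := fun x => by
        by_cases hx : x ∈ C
        · obtain ⟨g, hg⟩ := ih (Order.succ x) (hαlim.succ_lt (hCα x hx))
            ((hαlim.succ_lt (hCα x hx)).trans hα)
          exact ⟨g, fun _ δ hδ δ' hδ' h h' => hg δ hδ δ' hδ' h (Order.lt_succ_of_le h')⟩
        · exact ⟨fun _ => Classical.arbitrary Θ, fun h => absurd h hx⟩
      choose g hg using ih'
      let next : Ordinal.{u} → Ordinal.{u} := fun δ => sInf {x | x ∈ C ∧ δ ≤ x}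
      have hnext : ∀ δ < α, next δ ∈ C ∧ δ ≤ next δ := fun δ hδ => csInf_mem (hCc δ hδ)
      refine ⟨fun δ => max (g (next δ) δ) (lev δ (c δ)), fun δ hδ δ' hδ' hlt' hδα ν h1 h2 => ?_⟩
      have hn := hnext δ (hlt'.trans hδα)
      have hn' := hnext δ' hδα
      rcases lt_or_ge (next δ) δ' with h | h
      · refine ⟨lev δ' (c δ'), (le_max_right _ _).trans h2, ne_of_lt ?_⟩
        have h3 := hc δ' hδ' hδα
        exact (hlt δ hδ _).trans_le (hn.2.trans ((h3.2 _ hn.1 h).trans (hlev δ' _ hδ' h3.1)))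
      · have heq : next δ' = next δ := by
          refine le_antisymm (csInf_le' ⟨hn.1, h⟩) (csInf_le' ⟨hn'.1, hlt'.le.trans hn'.2⟩)
        refine hg (next δ) hn.1 δ hδ δ' hδ' hlt' h ν ((le_max_left _ _).trans h1) ?_
        have h4 := (le_max_left _ _).trans h2
        rwa [heq] at h4

/-! ### Uniqueness of direct limits, and quotients of direct sums -/

section Modules

variable {S : Type u} [Ring S] {A : ObjectProperty (ModuleCat.{u} S)}

open Classical in
theorem IsDirLim.nonempty_equiv_directLimit {D : Type u} [Preorder D] [IsDirectedOrder D]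
    [Nonempty D] {G : D → Type u} [∀ i, AddCommGroup (G i)] [∀ i, Module S (G i)]
    {f : ∀ i j, i ≤ j → G i →ₗ[S] G j} {N : Type u} [AddCommGroup N] [Module S N]
    {φ : ∀ i, G i →ₗ[S] N} (h : IsDirLim f φ) :
    Nonempty (Module.DirectLimit G f ≃ₗ[S] N) := by
  refine ⟨LinearEquiv.ofBijective (Module.DirectLimit.lift S D G f φ h.compat) ⟨?_, fun y => ?_⟩⟩
  · rw [injective_iff_map_eq_zero]
    intro z hz
    obtain ⟨i, x, rfl⟩ := Module.DirectLimit.exists_of z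
    rw [Module.DirectLimit.lift_of] at hz
    obtain ⟨j, hij, h0⟩ := h.zero i x hz
    rw [← Module.DirectLimit.of_f (hij := hij), h0, map_zero]
  · obtain ⟨i, x, rfl⟩ := h.surj y
    exact ⟨Module.DirectLimit.of S D G f i x, Module.DirectLimit.lift_of _ _ _⟩

theorem IsDirLim.nonempty_equiv {D : Type u} [Preorder D] [IsDirectedOrder D]
    [Nonempty D] {G : D → Type u} [∀ i, AddCommGroup (G i)] [∀ i, Module S (G i)]
    {f : ∀ i j, i ≤ j → G i →ₗ[S] G j} {N N' : Type u} [AddCommGroup N] [Module S N]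
    [AddCommGroup N'] [Module S N'] {φ : ∀ i, G i →ₗ[S] N} (h : IsDirLim f φ)
    {φ' : ∀ i, G i →ₗ[S] N'} (h' : IsDirLim f φ') : Nonempty (N ≃ₗ[S] N') := by
  obtain ⟨e⟩ := h.nonempty_equiv_directLimit
  obtain ⟨e'⟩ := h'.nonempty_equiv_directLimit
  exact ⟨e.symm.trans e'⟩

theorem nonempty_quotient_equiv_prod {M : Type u} [AddCommGroup M] [Module S M]
    {U T K N : Submodule S M} (hUT : U ≤ T) (hN : T ⊔ K = N) (hTK : T ⊓ K = ⊥) :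
    Nonempty ((N ⧸ U.submoduleOf N) ≃ₗ[S] ((T ⧸ U.submoduleOf T) × K)) := by
  have hTN : T ≤ N := hN ▸ le_sup_left
  have hKN : K ≤ N := hN ▸ le_sup_right
  let h : (T × K) →ₗ[S] (N ⧸ U.submoduleOf N) := (U.submoduleOf N).mkQ ∘ₗ
    (Submodule.inclusion hTN).coprod (Submodule.inclusion hKN)
  let k : (T × K) →ₗ[S] ((T ⧸ U.submoduleOf T) × K) :=
    ((U.submoduleOf T).mkQ).prodMap LinearMap.id
  have hh : Function.Surjective h := by
    refine (Submodule.mkQ_surjective _).comp ?_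
    rintro ⟨y, hy⟩
    rw [← hN] at hy
    obtain ⟨t, ht, l, hl, rfl⟩ := Submodule.mem_sup.1 hy
    exact ⟨(⟨t, ht⟩, ⟨l, hl⟩), rfl⟩
  have hk : Function.Surjective k :=
    Function.Surjective.prodMap (Submodule.mkQ_surjective _) Function.surjective_id
  have hker : LinearMap.ker h = LinearMap.ker k := by
    ext ⟨⟨t, ht⟩, ⟨l, hl⟩⟩
    have h1 : (⟨⟨t, ht⟩, ⟨l, hl⟩⟩ : T × K) ∈ LinearMap.ker h ↔ t + l ∈ U :=
      Submodule.Quotient.mk_eq_zero (U.submoduleOf N)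
    have h2 : (⟨⟨t, ht⟩, ⟨l, hl⟩⟩ : T × K) ∈ LinearMap.ker k ↔ t ∈ U ∧ l = 0 := by
      rw [LinearMap.mem_ker, Prod.ext_iff]
      exact and_congr (Submodule.Quotient.mk_eq_zero (U.submoduleOf T)) (Submodule.mk_eq_zero _ _)
    rw [h1, h2]
    constructor
    · intro h
      have hlT : l ∈ T ⊓ K := ⟨by simpa using T.sub_mem (hUT h) ht, hl⟩
      rw [hTK, Submodule.mem_bot] at hlT
      subst hlT
      exact ⟨by simpa using h, rfl⟩
    · rintro ⟨h, rfl⟩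
      simpa using h
  exact ⟨(h.quotKerEquivOfSurjective hh).symm.trans
    ((Submodule.quotEquivOfEq _ _ hker).trans (k.quotKerEquivOfSurjective hk))⟩

theorem span_preimage_coe {M : Type u} [AddCommGroup M] [Module S M] {N : Submodule S M} {s : Set M}
    (h : s ⊆ N) :
    Submodule.span S (Subtype.val ⁻¹' s : Set N) = (Submodule.span S s).submoduleOf N := by
  apply Submodule.map_injective_of_injective N.injective_subtype
  have h1 : (Subtype.val : N → M) '' (Subtype.val ⁻¹' s) = s := by
    rw [Set.image_preimage_eq_inter_range, Subtype.range_coe]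
    exact Set.inter_eq_left.2 h
  rw [Submodule.map_span]
  change Submodule.span S ((Subtype.val : N → M) '' (Subtype.val ⁻¹' s)) = _
  rw [h1, Submodule.submoduleOf, Submodule.map_comap_subtype]
  exact (inf_eq_right.2 (Submodule.span_le.2 h)).symm

end Modules

/-! ### The continuous chain of tree modules and its quotients -/

section TreeChain

variable {S : Type u} [Ring S] {Θ V : Type u} [Inhabited V] [LinearOrder Θ]
  {G : Θ → Type u} [∀ i, AddCommGroup (G i)] [∀ i, Module S (G i)]

/-- The sequences (with their lengths) whose values have ranks bounded below `α`. -/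
def shortPaths (Θ : Type u) [LinearOrder Θ] (r : V → Ordinal.{u}) (α : Ordinal.{u}) :
    Set (Θ × (Θ → V)) :=
  {p | (∀ μ, p.1 ≤ μ → p.2 μ = default) ∧ ∃ β < α, ∀ μ < p.1, r (p.2 μ) < β}

/-- The generators of the `α`-th member of the chain of tree modules. -/
def treeGens (f : ∀ i j, i ≤ j → G i →ₗ[S] G j) (r : V → Ordinal.{u}) (E : Set Ordinal.{u})
    (η : V → Θ → V) (α : Ordinal.{u}) : Set (∀ c : Θ × (Θ → V), G c.1) :=
  pathGens f (shortPaths Θ r α) fun v : {v : V // r v ∈ E ∧ r v < α} => η v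

variable {f : ∀ i j, i ≤ j → G i →ₗ[S] G j} {r : V → Ordinal.{u}} {E : Set Ordinal.{u}}
  {η : V → Θ → V}

theorem treeGens_mono : Monotone (treeGens f r E η) := by
  rintro α α' h y (⟨p, ⟨hp, β, hβ, hpβ⟩, a, ha, x, rfl⟩ | ⟨⟨v, hv, hvα⟩, a, x, rfl⟩)
  · exact Or.inl ⟨p, ⟨hp, β, hβ.trans_le h, hpβ⟩, a, ha, x, rfl⟩
  · exact Or.inr ⟨⟨v, hv, hvα.trans_le h⟩, a, x, rfl⟩

theorem exists_lt_mem_treeGens {α : Ordinal.{u}} (hα : Order.IsSuccLimit α)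
    {y : ∀ c : Θ × (Θ → V), G c.1} (hy : y ∈ treeGens f r E η α) :
    ∃ β < α, y ∈ treeGens f r E η β := by
  rcases hy with ⟨p, ⟨hp, β, hβ, hpβ⟩, a, ha, x, rfl⟩ | ⟨⟨v, hv, hvα⟩, a, x, rfl⟩
  · exact ⟨Order.succ β, hα.succ_lt hβ,
      Or.inl ⟨p, ⟨hp, β, Order.lt_succ β, hpβ⟩, a, ha, x, rfl⟩⟩
  · exact ⟨Order.succ (r v), hα.succ_lt hvα, Or.inr ⟨⟨v, hv, Order.lt_succ _⟩, a, x, rfl⟩⟩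

theorem cut_mem_shortPaths {t : Θ → V} {b : Θ} {α β : Ordinal.{u}} (hβ : β < α)
    (h : ∀ μ < b, r (t μ) < β) : (b, cut (Set.Iio b) t) ∈ shortPaths Θ r α :=
  ⟨fun μ hμ => cut_of_notMem (s := Set.Iio b) (not_lt.2 hμ), β, hβ, fun μ hμ => by
    change r (cut (Set.Iio b) t μ) < β
    rw [cut_of_mem (s := Set.Iio b) hμ]
    exact h μ hμ⟩

theorem path_mem_treeGens {t : Θ → V} {b a : Θ} {α β : Ordinal.{u}} (hβ : β < α)
    (h : ∀ μ < b, r (t μ) < β) (ha : a < b) (x : G a) :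
    path f t b a x ∈ treeGens f r E η α := by
  refine Or.inl ⟨_, cut_mem_shortPaths hβ h, a, ha, x, ?_⟩
  rw [path_congr f fun μ hμ => cut_of_mem (s := Set.Iio b) (WithTop.coe_lt_coe.1 hμ)]

/-- Initial segments of the branch of v are admissible short paths because `r v` < α itself bounds
the ladder; the separation then feeds `pathGens_mem`. -/
theorem treeGens_mem {A : ObjectProperty (ModuleCat.{u} S)} [WellFoundedLT Θ] [Nonempty Θ]
    (hA : ClosedUnderFiltrations A) (hid : ∀ i x, f i i le_rfl x = x)
    (hf : ∀ i j k hij hjk x, f j k hjk (f i j hij x) = f i k (hij.trans hjk) x)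
    (hG : ∀ a, A (ModuleCat.of S (G a)))
    (hdl : ∀ b : Θ, (Set.Iio b).Nonempty → ∀ (N : Type u) [AddCommGroup N] [Module S N]
      (φ : ∀ i : Set.Iio b, G i →ₗ[S] N),
      IsDirLim (fun (i j : Set.Iio b) (h : i ≤ j) => f i j h) φ → A (ModuleCat.of S N))
    {α : Ordinal.{u}} (hlt : ∀ v, r v ∈ E → ∀ a, r (η v a) < r v)
    (hsep : ∃ g : V → Θ, ∀ v v', r v ∈ E → r v' ∈ E → r v < α → r v' < α → v ≠ v' →
      ∀ ν, g v ≤ ν → g v' ≤ ν → ∃ μ ≤ ν, η v μ ≠ η v' μ) :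
    A (ModuleCat.of S (Submodule.span S (treeGens f r E η α))) := by
  obtain ⟨g, hg⟩ := hsep
  refine hA.pathGens_mem f hid hf hG hdl (fun p hp => hp.1) ?_ ?_ (fun v => g v) ?_
  · rintro p ⟨-, β, hβ, h⟩ b hb
    exact cut_mem_shortPaths hβ fun μ hμ => h μ (hμ.trans hb)
  · rintro ⟨v, hv, hvα⟩ b
    exact cut_mem_shortPaths hvα fun μ _ => hlt v hv μ
  · rintro ⟨v, hv, hvα⟩ ⟨v', hv', hvα'⟩ hne ν h1 h2
    exact hg v v' hv hv' hvα hvα' (fun h => hne (Subtype.ext h)) ν h1 h2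

/-- The elements whose support consists of paths with values of rank less than `α`. -/
def supportedBelow (S : Type u) [Ring S] (G : Θ → Type u) [∀ i, AddCommGroup (G i)]
    [∀ i, Module S (G i)] (r : V → Ordinal.{u}) (α : Ordinal.{u}) :
    Submodule S (∀ c : Θ × (Θ → V), G c.1) where
  carrier := {y | ∀ c, (∃ μ ≤ c.1, α ≤ r (c.2 μ)) → y c = 0}
  zero_mem' := fun c _ => rfl
  add_mem' := fun hx hy c hc => by rw [Pi.add_apply, hx c hc, hy c hc, add_zero]
  smul_mem' := fun s x hx c hc => by rw [Pi.smul_apply, hx c hc, smul_zero]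

/-- The elements whose support consists of paths with some value of rank at least `α`. -/
def supportedAbove (S : Type u) [Ring S] (G : Θ → Type u) [∀ i, AddCommGroup (G i)]
    [∀ i, Module S (G i)] (r : V → Ordinal.{u}) (α : Ordinal.{u}) :
    Submodule S (∀ c : Θ × (Θ → V), G c.1) where
  carrier := {y | ∀ c, (¬ ∃ μ ≤ c.1, α ≤ r (c.2 μ)) → y c = 0}
  zero_mem' := fun c _ => rfl
  add_mem' := fun hx hy c hc => by rw [Pi.add_apply, hx c hc, hy c hc, add_zero]
  smul_mem' := fun s x hx c hc => by rw [Pi.smul_apply, hx c hc, smul_zero]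

theorem path_mem_supportedBelow {t : Θ → V} {ℓ : WithTop Θ} {α : Ordinal.{u}}
    (h : ∀ μ : Θ, (μ : WithTop Θ) < ℓ → r (t μ) < α) {a : Θ} (x : G a) :
    path f t ℓ a x ∈ supportedBelow S G r α := by
  rintro c ⟨μ, hμ, hμα⟩
  refine path_apply_of_neg f ?_ x
  rintro ⟨-, h2, h3⟩
  rw [h3, cut_of_mem (s := Set.Iic c.1) hμ] at hμα
  exact hμα.not_gt (h μ ((WithTop.coe_le_coe.2 hμ).trans_lt h2))

theorem path_mem_supportedAbove {t : Θ → V} {ℓ : WithTop Θ} {α : Ordinal.{u}} {a b : Θ}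
    (hba : b ≤ a) (h : α ≤ r (t b)) (x : G a) :
    path f t ℓ a x ∈ supportedAbove S G r α := by
  intro c hc
  refine path_apply_of_neg f ?_ x
  rintro ⟨h1, -, h3⟩
  refine hc ⟨b, hba.trans h1, ?_⟩
  rwa [h3, cut_of_mem (s := Set.Iic c.1) (hba.trans h1)]

/-- If `r v = α` is in `E`, then the quotient by the `α`-th tree module has the direct limit of the
system as a direct summand. -/
theorem exists_isDirLim_summand [WellFoundedLT Θ] [Nonempty Θ]
    (hf : ∀ i j k hij hjk x, f j k hjk (f i j hij x) = f i k (hij.trans hjk) x)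
    (hmono : ∀ v, r v ∈ E → Monotone fun a => r (η v a))
    (hlt : ∀ v, r v ∈ E → ∀ a, r (η v a) < r v)
    (hcof : ∀ v, r v ∈ E → ∀ β < r v, ∃ a, β ≤ r (η v a))
    (hr : Function.Injective r) {v : V} (hv : r v ∈ E) (hlim : Order.IsSuccLimit (r v))
    (hΘ : ∀ b : Θ, #(Set.Iio b) < (r v).cof) {o : Ordinal.{u}} (hvo : r v < o) :
    ∃ (T : Type u) (_ : AddCommGroup T) (_ : Module S T) (φ : ∀ a, G a →ₗ[S] T) (K : Type u)
      (_ : AddCommGroup K) (_ : Module S K), IsDirLim f φ ∧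
      Nonempty ((Submodule.span S (treeGens f r E η o) ⧸
        (Submodule.span S (treeGens f r E η (r v))).submoduleOf
          (Submodule.span S (treeGens f r E η o))) ≃ₗ[S] T × K) := by
  set U := Submodule.span S (treeGens f r E η (r v)) with hU
  set N := Submodule.span S (treeGens f r E η o) with hN
  let B := ⨆ a, LinearMap.range (path f (η v) ⊤ a)
  let T := B ⊔ U
  let K := supportedAbove S G r (r v) ⊓ N
  have hUN : U ≤ N := Submodule.span_mono (treeGens_mono hvo.le)
  have hBN : B ≤ N := by
    refine iSup_le fun a => ?_
    rintro _ ⟨x, rfl⟩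
    exact Submodule.subset_span (Or.inr ⟨⟨v, hv, hvo⟩, a, x, rfl⟩)
  have hbelow : T ≤ supportedBelow S G r (r v) := by
    refine sup_le (iSup_le fun a => ?_) (Submodule.span_le.2 ?_)
    · rintro _ ⟨x, rfl⟩
      exact path_mem_supportedBelow (fun μ _ => hlt v hv μ) x
    · rintro _ (⟨p, ⟨hp, β, hβ, hpβ⟩, a, ha, x, rfl⟩ | ⟨⟨w, hw, hwα⟩, a, x, rfl⟩)
      · exact path_mem_supportedBelow (fun μ hμ => (hpβ μ (WithTop.coe_lt_coe.1 hμ)).trans hβ) x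
      · exact path_mem_supportedBelow (fun μ _ => (hlt w hw μ).trans hwα) x
  -- A proper initial segment has fewer entries than the cofinality of `r v`, so entries below `r v`
  -- are bounded strictly below it.
  have hbdd : ∀ (t : Θ → V) (b : Θ), (∀ μ < b, r (t μ) < r v) →
      ∃ β < r v, ∀ μ < b, r (t μ) < β := fun t b h => by
    refine ⟨Order.succ (⨆ μ : Set.Iio b, r (t μ)), hlim.succ_lt
      (Ordinal.iSup_lt_of_lt_cof (hΘ b) fun μ => h μ μ.2), fun μ hμ => ?_⟩
    exact Order.lt_succ_of_le (Ordinal.le_iSup (fun μ : Set.Iio b => r (t μ)) ⟨μ, hμ⟩)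
  have hsplit : ∀ (t : Θ → V) (ℓ : WithTop Θ) (a : Θ) (x : G a), path f t ℓ a x ∈ N →
      (∃ b : Θ, (b : WithTop Θ) < ℓ ∧ r v ≤ r (t b)) → path f t ℓ a x ∈ T ⊔ K := by
    intro t ℓ a x hx hb
    -- The path is cut at its first entry of rank at least `r v`: the part before is a bounded short
    -- path, hence in U, and the part after is in K.
    obtain ⟨b, ⟨hbℓ, hb⟩, hmin⟩ := WellFounded.has_min (wellFounded_lt (α := Θ))
      {b | (b : WithTop Θ) < ℓ ∧ r v ≤ r (t b)} hb
    rcases le_or_gt b a with h | h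
    · exact Submodule.mem_sup_right ⟨path_mem_supportedAbove h hb x, hx⟩
    · obtain ⟨β, hβ, hβt⟩ := hbdd t b fun μ hμ => by
        by_contra hcon
        exact hmin μ ⟨(WithTop.coe_lt_coe.2 hμ).trans hbℓ, not_lt.1 hcon⟩ hμ
      have h1 : path f t b a x ∈ U := Submodule.subset_span (path_mem_treeGens hβ hβt h x)
      have h2 := path_split f hf t h.le hbℓ.le x
      have h3 : path f t ℓ b (f a b h.le x) ∈ N := by
        have := N.sub_mem hx (hUN h1)
        rwa [h2, add_sub_cancel_left] at this
      rw [h2]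
      exact Submodule.add_mem_sup (Submodule.mem_sup_right h1)
        ⟨path_mem_supportedAbove le_rfl hb _, h3⟩
  have hTK : T ⊔ K = N := by
    refine le_antisymm (sup_le (sup_le hBN hUN) inf_le_right) (Submodule.span_le.2 ?_)
    intro y hy
    have hyN : y ∈ N := Submodule.subset_span hy
    rcases hy with ⟨p, ⟨hp, β, hβ, hpβ⟩, a, ha, x, rfl⟩ | ⟨⟨w, hw, hwα⟩, a, x, rfl⟩
    · by_cases h : ∃ b : Θ, b < p.1 ∧ r v ≤ r (p.2 b)
      · obtain ⟨b, hb, hb'⟩ := h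
        exact hsplit _ _ _ _ hyN ⟨b, WithTop.coe_lt_coe.2 hb, hb'⟩
      · push Not at h
        obtain ⟨β', hβ', hp'⟩ := hbdd _ _ h
        exact Submodule.mem_sup_left (Submodule.mem_sup_right
          (Submodule.subset_span (path_mem_treeGens hβ' hp' ha x)))
    · rcases lt_trichotomy (r w) (r v) with h | h | h
      · exact Submodule.mem_sup_left (Submodule.mem_sup_right
          (Submodule.subset_span (Or.inr ⟨⟨w, hw, h⟩, a, x, rfl⟩)))
      · have := hr h
        subst this
        exact Submodule.mem_sup_left (Submodule.mem_sup_left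
          ((le_iSup (fun a => LinearMap.range (path f (η w) ⊤ a)) a) ⟨x, rfl⟩))
      · obtain ⟨b, hb⟩ := hcof w hw _ h
        exact hsplit _ _ _ _ hyN ⟨b, WithTop.coe_lt_top b, hb⟩
  have hdisj : T ⊓ K = ⊥ := by
    rw [eq_bot_iff]
    rintro y ⟨hy, hy', -⟩
    rw [Submodule.mem_bot]
    ext c
    by_cases hc : ∃ μ ≤ c.1, r v ≤ r (c.2 μ)
    · exact hbelow hy c hc
    · exact hy' c hc
  have hex : ∃ b : Θ, (b : WithTop Θ) < ⊤ := ⟨Classical.arbitrary Θ, WithTop.coe_lt_top _⟩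
  -- The ladder of v is cofinal in `r v`, so it reaches the bound of any given short path, and the
  -- ordinal of any earlier ladder, and thereby leaves that path.
  have hUV : U ≤ eventuallyVanishing S G (η v) ⊤ hex := by
    refine Submodule.span_le.2 ?_
    rintro _ (⟨p, ⟨hp, β, hβ, hpβ⟩, a, ha, x, rfl⟩ | ⟨⟨w, hw, hwα⟩, a, x, rfl⟩)
    · obtain ⟨b, hb⟩ := hcof v hv β hβ
      refine range_path_le_eventuallyVanishing f hex ⟨b, WithTop.coe_lt_top b, Or.inr ?_⟩ ⟨x, rfl⟩
      rcases le_or_gt p.1 b with h | h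
      · exact Or.inl (WithTop.coe_le_coe.2 h)
      · exact Or.inr fun h' => (hb.trans (h' ▸ le_rfl)).not_gt (hpβ b h)
    · obtain ⟨b, hb⟩ := hcof v hv _ hwα
      refine range_path_le_eventuallyVanishing f hex
        ⟨b, WithTop.coe_lt_top b, Or.inr (Or.inr fun h' => ?_)⟩ ⟨x, rfl⟩
      exact (hb.trans (h' ▸ le_rfl)).not_gt (hlt w hw b)
  have hBT : ∀ a x, path f (η v) ⊤ a x ∈ T := fun a x => Submodule.mem_sup_left
    ((le_iSup (fun a => LinearMap.range (path f (η v) ⊤ a)) a) ⟨x, rfl⟩)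
  refine ⟨T ⧸ U.submoduleOf T, inferInstance, inferInstance, _, K, inferInstance, inferInstance,
    isDirLim_quotient f (fun a => path f (η v) ⊤ a) (W := T) (U := U) hBT ?_
      (fun y hy => hy) ?_, nonempty_quotient_equiv_prod le_sup_right hTK hdisj⟩
  · intro i j h x
    rw [path_split f hf (η v) h le_top, add_sub_cancel_right]
    rcases eq_or_lt_of_le h with h | h
    · subst h
      have : path f (η v) (i : Θ) i x = 0 := by
        ext c
        exact path_apply_of_neg f (fun h => (WithTop.coe_lt_coe.1 h.2.1).not_ge h.1) x
      rw [this]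
      exact U.zero_mem
    · refine Submodule.subset_span (path_mem_treeGens (β := Order.succ (r (η v j)))
        (hlim.succ_lt (hlt v hv j)) (fun μ hμ => Order.lt_succ_of_le ?_) h x)
      exact hmono v hv hμ.le
  · intro i x hx
    obtain ⟨b, hab, -, h0⟩ := path_zero_of_mem_eventuallyVanishing f
      (WithTop.coe_lt_top i) (hUV hx)
    exact ⟨b, hab, h0⟩

end TreeChain

/-! ### Size of the tree modules, and limits of chains of regular length -/

/-- A bounded sequence is determined by a bound, a length and a function from its length into at
most κ values; each of these leaves at most κ choices. This is where κ^{<θ} = κ enters. -/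
theorem mk_shortPaths_le {Θ V : Type u} [Inhabited V] [LinearOrder Θ] {r : V → Ordinal.{u}}
    {α : Ordinal.{u}} {κ : Cardinal.{u}} (hκ : ℵ₀ ≤ κ) (hΘ : #Θ ≤ κ)
    (hpow : ∀ b : Θ, κ ^ #(Set.Iio b) ≤ κ) (hr : ∀ β < α, ∃ v, r v = β)
    (hα : #{v | r v < α} ≤ κ) (hV : ∀ v, #{w | r w < r v} ≤ κ) :
    #(shortPaths Θ r α) ≤ κ := by
  let X : V → Θ → Set (Θ × (Θ → V)) := fun v ℓ =>
    {p | p.1 = ℓ ∧ (∀ μ, ℓ ≤ μ → p.2 μ = default) ∧ ∀ μ < ℓ, r (p.2 μ) < r v}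
  have hX : ∀ v ℓ, #(X v ℓ) ≤ κ := fun v ℓ => by
    let F : X v ℓ → Set.Iio ℓ → {w | r w < r v} := fun p μ => ⟨p.1.2 μ, p.2.2.2 μ μ.2⟩
    have hF : Function.Injective F := by
      rintro ⟨⟨ℓ₁, t⟩, rfl, h1, h2⟩ ⟨⟨ℓ₂, t'⟩, h3, h1', h2'⟩ h
      obtain rfl : ℓ₂ = ℓ₁ := h3
      have : t = t' := by
        ext μ
        rcases lt_or_ge μ ℓ₂ with hμ | hμ
        · exact congrArg Subtype.val (congrFun h ⟨μ, hμ⟩)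
        · exact (h1 μ hμ).trans (h1' μ hμ).symm
      subst this
      rfl
    refine (mk_le_of_injective hF).trans ?_
    rw [← power_def]
    exact (power_le_power_right (hV v)).trans (hpow ℓ)
  have hsub : shortPaths Θ r α ⊆ ⋃ v ∈ {v | r v < α}, ⋃ ℓ, X v ℓ := by
    rintro ⟨ℓ, t⟩ ⟨h1, β, hβ, h2⟩
    obtain ⟨v, rfl⟩ := hr β hβ
    exact Set.mem_biUnion (show v ∈ {v | r v < α} from hβ) (Set.mem_iUnion.2 ⟨ℓ, rfl, h1, h2⟩)
  exact (mk_le_mk_of_subset hsub).trans (mk_biUnion_le_of_le' hκ _ _ hα fun v _ =>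
    mk_iUnion_le_of_le hκ _ hΘ (hX v))

section Modules

variable {S : Type u} [Ring S] {A : ObjectProperty (ModuleCat.{u} S)} {ξ : Cardinal.{u}}

theorem mk_treeGens_le {Θ V : Type u} [Inhabited V] [LinearOrder Θ] {G : Θ → Type u}
    [∀ i, AddCommGroup (G i)] [∀ i, Module S (G i)] {f : ∀ i j, i ≤ j → G i →ₗ[S] G j}
    {r : V → Ordinal.{u}} {E : Set Ordinal.{u}} {η : V → Θ → V} {α : Ordinal.{u}}
    {κ : Cardinal.{u}} (hκ : ℵ₀ ≤ κ) (hΘ : #Θ ≤ κ) (hG : ∀ a, #(G a) ≤ κ)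
    (hpow : ∀ b : Θ, κ ^ #(Set.Iio b) ≤ κ) (hr : ∀ β < α, ∃ v, r v = β)
    (hα : #{v | r v < α} ≤ κ) (hV : ∀ v, #{w | r w < r v} ≤ κ) :
    #(treeGens f r E η α) ≤ κ := by
  have hsub : treeGens f r E η α ⊆
      (⋃ p ∈ shortPaths Θ r α, ⋃ a, Set.range fun x => path f p.2 p.1 a x) ∪
      ⋃ v ∈ {v | r v < α}, ⋃ a, Set.range fun x => path f (η v) ⊤ a x := by
    rintro y (⟨p, hp, a, ha, x, rfl⟩ | ⟨⟨v, hv, hvα⟩, a, x, rfl⟩)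
    · exact Or.inl (Set.mem_biUnion hp (Set.mem_iUnion.2 ⟨a, x, rfl⟩))
    · exact Or.inr (Set.mem_biUnion (show v ∈ {v | r v < α} from hvα)
        (Set.mem_iUnion.2 ⟨a, x, rfl⟩))
  refine (mk_le_mk_of_subset hsub).trans ((mk_union_le _ _).trans (add_le_of_le hκ ?_ ?_))
  · exact mk_biUnion_le_of_le' hκ _ _ (mk_shortPaths_le hκ hΘ hpow hr hα hV) fun p _ =>
      mk_iUnion_le_of_le hκ _ hΘ fun a => mk_range_le.trans (hG a)
  · exact mk_biUnion_le_of_le' hκ _ _ hα fun v _ =>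
      mk_iUnion_le_of_le hκ _ hΘ fun a => mk_range_le.trans (hG a)

/-- The direct limit of a system of members of `A` indexed by a regular cardinal belongs to `A` if
the direct limits of its proper initial segments do. -/
theorem mem_of_isDirLim_chain (hstar : AssumptionStar.{u})
    (hfilt : A = Filt (ltPresentedPart A ξ)) (hξ : ℵ₀ < ξ)
    (hsum : ClosedUnderDirectSummands A)
    (hlim : ClosedUnderContinuousMonoWellOrderedLimits ξ A)
    {θ : Cardinal.{u}} (hθ : θ.IsRegular) {G : θ.ord.ToType → Type u}
    [∀ i, AddCommGroup (G i)] [∀ i, Module S (G i)] {f : ∀ i j, i ≤ j → G i →ₗ[S] G j}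
    (hid : ∀ i x, f i i le_rfl x = x)
    (hf : ∀ i j k hij hjk x, f j k hjk (f i j hij x) = f i k (hij.trans hjk) x)
    (hG : ∀ a, A (ModuleCat.of S (G a)))
    (hdl : ∀ b : θ.ord.ToType, (Set.Iio b).Nonempty → ∀ (N : Type u) [AddCommGroup N] [Module S N]
      (φ : ∀ i : Set.Iio b, G i →ₗ[S] N),
      IsDirLim (fun (i j : Set.Iio b) (h : i ≤ j) => f i j h) φ → A (ModuleCat.of S N))
    {N : Type u} [AddCommGroup N] [Module S N] {φ : ∀ a, G a →ₗ[S] N} (hN : IsDirLim f φ) :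
    A (ModuleCat.of S N) := by
  classical
  have hA := closedUnderFiltrations_of_eq_filt hfilt
  let Θ := θ.ord.ToType
  have : Nonempty Θ := by
    rw [Ordinal.nonempty_toType_iff]
    exact hθ.ord_pos.ne'
  -- κ ≥ ξ is needed for the Hill-type argument and for continuity; κ ≥ θ and κ ≥ |G_a| keep the
  -- generators of each stage at most κ in number.
  obtain ⟨κ, hμκ, ⟨E, hE, hEcof⟩, hpow⟩ := hstar θ hθ (max ξ (max θ #(Σ a, G a)))
  have hξκ : ξ ≤ κ := (le_max_left _ _).trans hμκ
  have hθκ : θ ≤ κ := (le_max_left _ _).trans ((le_max_right _ _).trans hμκ)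
  have hGκ : #(Σ a, G a) ≤ κ := (le_max_right _ _).trans ((le_max_right _ _).trans hμκ)
  have hκ : ℵ₀ ≤ κ := hξ.le.trans hξκ
  have hElim : ∀ α ∈ E, Order.IsSuccLimit α := fun α hα =>
    Ordinal.one_lt_cof_iff.1 (by
      rw [hEcof α hα]
      exact one_lt_aleph0.trans_le hθ.aleph0_le)
  set o : Ordinal.{u} := (Order.succ κ).ord with ho
  have ho0 : 0 < o := (isRegular_succ hκ).ord_pos
  have holim : Order.IsSuccLimit o := isSuccLimit_ord (hκ.trans (Order.le_succ κ))
  let V := o.ToType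
  let r : V → Ordinal.{u} := fun v => (Ordinal.ToType.mk.symm v : Ordinal.{u})
  -- This inverts r below κ⁺; its values beyond are irrelevant.
  let i : Ordinal.{u} → V := fun β => if h : β < o then Ordinal.ToType.mk ⟨β, h⟩ else
    Ordinal.ToType.mk ⟨0, ho0⟩
  have hri : ∀ β < o, r (i β) = β := fun β hβ => by simp [r, i, hβ]
  have hrinj : Function.Injective r := fun v w h =>
    Ordinal.ToType.mk.symm.injective (Subtype.ext h)
  have hro : ∀ v, r v < o := fun v => (Ordinal.ToType.mk.symm v).2
  have hrlt : ∀ v w, r v < r w ↔ v < w := fun v w => by simp [r]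
  let : Inhabited V := ⟨i 0⟩
  have hex : ∀ δ, ∃ η : Θ → Ordinal.{u}, δ ∈ E →
      Monotone η ∧ (∀ a, η a < δ) ∧ ∀ β < δ, ∃ a, β ≤ η a := fun δ => by
    by_cases h : δ ∈ E
    · obtain ⟨η, hη⟩ := exists_monotone_cofinal (hEcof δ h)
      exact ⟨η, fun _ => hη⟩
    · exact ⟨fun _ => 0, fun h' => absurd h' h⟩
  choose η₀ hη₀ using hex
  let η : V → Θ → V := fun v a => i (η₀ (r v) a)
  have hrη : ∀ v, r v ∈ E → ∀ a, r (η v a) = η₀ (r v) a := fun v hv a =>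
    hri _ (((hη₀ _ hv).2.1 a).trans (hro v))
  have hlt : ∀ v, r v ∈ E → ∀ a, r (η v a) < r v := fun v hv a => by
    rw [hrη v hv]; exact (hη₀ _ hv).2.1 a
  have hVr : ∀ v, #{w | r w < r v} ≤ κ := fun v => by
    have : {w | r w < r v} = Set.Iio v := by ext w; exact hrlt w v
    rw [this]
    exact Order.lt_succ_iff.1 (mk_Iio_lt_of_toType v)
  have hVα : ∀ α < o, #{w | r w < α} ≤ κ := fun α hα => by
    have := hVr (i α)
    rwa [hri α hα] at this
  have hmem : ∀ α < o, A (ModuleCat.of S (Submodule.span S (treeGens f r E η α))) := by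
    intro α hα
    refine treeGens_mem hA hid hf hG hdl hlt ?_
    obtain ⟨g, hg⟩ := hE.exists_separation hElim (fun δ hδ => (hη₀ δ hδ).2.1)
      (fun δ hδ => (hη₀ δ hδ).2.2) hα
    refine ⟨fun v => g (r v), fun v v' hv hv' hvα hvα' hne ν h1 h2 => ?_⟩
    obtain ⟨μ, hμ, h⟩ := hg _ hv _ hv' hvα hvα' (fun h => hne (hrinj h)) ν h1 h2
    refine ⟨μ, hμ, fun h' => h ?_⟩
    rw [← hrη v hv, ← hrη v' hv', h']
  have hcard : ∀ α < o, #(treeGens f r E η α) ≤ κ := fun α hα =>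
    mk_treeGens_le hκ (by simpa using hθκ)
      (fun a => (mk_le_of_injective sigma_mk_injective).trans hGκ)
      (fun b => (le_powerlt _ (mk_Iio_lt_of_toType b)).trans hpow.le)
      (fun β hβ => ⟨i β, hri β (hβ.trans hα)⟩) (hVα α hα) hVr
  set L := Submodule.span S (treeGens f r E η o) with hL
  let Gen : Ordinal.{u} → Set L := fun α => Subtype.val ⁻¹' treeGens f r E η α
  have hGen : Monotone Gen := fun α β h => Set.preimage_mono (treeGens_mono h)
  have hspan : ∀ α ≤ o, Submodule.span S (Gen α) =
      (Submodule.span S (treeGens f r E η α)).submoduleOf L := fun α hα =>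
    span_preimage_coe ((treeGens_mono hα).trans Submodule.subset_span)
  have hGlim : ∀ α, Order.IsSuccLimit α → ∀ y ∈ Gen α, ∃ β < α, y ∈ Gen β := fun α hα y hy => by
    obtain ⟨β, hβ, h⟩ := exists_lt_mem_treeGens (f := f) (r := r) (E := E) (η := η)
      (y := y.1) hα hy
    exact ⟨β, hβ, h⟩
  have hcont : ∀ α, Order.IsSuccLimit α →
      Submodule.span S (Gen α) ≤ ⨆ β : Set.Iio α, Submodule.span S (Gen β) := fun α hα => by
    refine Submodule.span_le.2 fun y hy => ?_
    obtain ⟨β, hβ, hy⟩ := hGlim α hα y hy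
    exact (le_iSup (fun β : Set.Iio α => Submodule.span S (Gen β)) ⟨β, hβ⟩)
      (Submodule.subset_span hy)
  have htop : ∀ y : L, ∃ α < o, y ∈ Submodule.span S (Gen α) := fun y => by
    have h1 : y ∈ Submodule.span S (Gen o) := by
      rw [hspan o le_rfl, Submodule.submoduleOf_self]
      trivial
    have h2 := hcont o holim h1
    have : Nonempty (Set.Iio o) := ⟨⟨0, ho0⟩⟩
    rw [Submodule.mem_iSup_of_directed (fun β : Set.Iio o => Submodule.span S (Gen β))
      (Monotone.directed_le fun α β h => Submodule.span_mono (hGen h))] at h2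
    obtain ⟨β, hβ⟩ := h2
    exact ⟨β, β.2, hβ⟩
  have hAL : A (ModuleCat.of S L) := by
    refine mem_of_continuous_chain hlim hκ hξκ (N := fun α => Submodule.span S (Gen α))
      (fun α β h => Submodule.span_mono (hGen h)) (fun α hα => ?_) hcont htop
    have hle : Submodule.span S (treeGens f r E η α) ≤ L :=
      Submodule.span_mono (treeGens_mono (le_of_lt hα))
    rw [hspan α (le_of_lt hα)]
    exact hA.of_equiv (Submodule.submoduleOfEquivOfLe hle).symm (hmem α hα)
  -- The filtration obtained here from L being in A is unrelated to the tree chain; comparing the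
  -- two yields the quotient in A.
  have hLfilt : HasFiltration (ltPresentedPart A ξ) L := by
    rw [hfilt] at hAL
    exact hAL.hasFiltration
  obtain ⟨J, _, _, ⟨P⟩⟩ := hLfilt.exists_presentedFiltration
  obtain ⟨α, hαE, hαo, hα⟩ := P.exists_quotient_mem hA hκ hξκ hGen
    (fun α hα => (mk_preimage_of_injective _ _ Subtype.val_injective).trans (hcard α hα))
    hGlim htop hE.stationary hElim
  rw [hspan α (le_of_lt hαo)] at hα
  have hv : r (i α) = α := hri α hαo
  obtain ⟨T, _, _, ψ, K, _, _, hT, hTK⟩ := exists_isDirLim_summand (v := i α) (E := E) (o := o)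
    (η := η) hf
    (fun v hv a b hab => by
      beta_reduce
      rw [hrη v hv, hrη v hv]
      exact (hη₀ _ hv).1 hab) hlt
    (fun v hv β hβ => by
      obtain ⟨a, ha⟩ := (hη₀ _ hv).2.2 β hβ
      exact ⟨a, by rwa [hrη v hv]⟩) hrinj (by rwa [hv]) (by rw [hv]; exact hElim α hαE)
    (fun b => by
      rw [hv, hEcof α hαE]
      exact mk_Iio_lt_of_toType b) (by rwa [hv])
  rw [hv] at hTK
  obtain ⟨e⟩ := hT.nonempty_equiv hN
  exact hA.of_equiv e (hsum _ (ModuleCat.of S T) (ModuleCat.of S K) hα hTK)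

end Modules

/-! ### Directed sets as chains of smaller directed subsets -/

theorem mk_iUnion_lt_of_lt_cof {ι α : Type u} {c : Cardinal.{u}} (hc : ℵ₀ ≤ c) {f : ι → Set α}
    (hι : #ι < c.ord.cof) (hf : ∀ i, #(f i) < c) : #(⋃ i, f i) < c :=
  (mk_iUnion_le f).trans_lt (mul_lt_of_lt hc (hι.trans_le (Ordinal.cof_ord_le c))
    (iSup_lt_of_lt_cof_ord hι hf))

section Directed

variable {D : Type u} [Preorder D] [IsDirectedOrder D] [Nonempty D]

/-- A subset of an infinite directed set is contained in a directed subset which is not larger, or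
finite. -/
theorem exists_directedOn_superset [Infinite D] {T : Set D} (hT : #T < #D) :
    ∃ T' : Set D, T ⊆ T' ∧ T'.Nonempty ∧ DirectedOn (· ≤ ·) T' ∧ #T' < #D := by
  rcases T.finite_or_infinite with h | h
  · obtain ⟨d, hd⟩ := h.bddAbove
    refine ⟨insert d T, Set.subset_insert _ _, Set.insert_nonempty _ _, fun x hx y hy =>
      ⟨d, Set.mem_insert _ _, ?_, ?_⟩,
      (lt_aleph0_iff_set_finite.2 (h.insert d)).trans_le (aleph0_le_mk D)⟩
    · rcases hx with rfl | hx
      exacts [le_rfl, hd hx]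
    · rcases hy with rfl | hy
      exacts [le_rfl, hd hy]
  · have h0 : ℵ₀ ≤ #T := infinite_iff.1 h.to_subtype
    choose ub hub₁ hub₂ using fun x y : D => exists_ge_ge x y
    obtain ⟨c, hc0, hc⟩ : ∃ c : ℕ → Set D, c 0 = T ∧
        ∀ n, c (n + 1) = c n ∪ Set.image2 ub (c n) (c n) :=
      ⟨fun n => Nat.rec T (fun _ s => s ∪ Set.image2 ub s s) n, rfl, fun n => rfl⟩
    have hmono : Monotone c := monotone_nat_of_le_succ fun n => by
      rw [hc]; exact Set.subset_union_left
    have hcard : ∀ n, #(c n) ≤ #T := fun n => by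
      induction n with
      | zero => rw [hc0]
      | succ n ih =>
        rw [hc]
        refine (mk_union_le _ _).trans (add_le_of_le h0 ih ?_)
        rw [← Set.image_uncurry_prod]
        refine mk_image_le.trans ?_
        rw [mk_setProd]
        exact (mul_le_mul' ih ih).trans (mul_eq_self h0).le
    refine ⟨⋃ n : ULift.{u} ℕ, c n.down, Set.subset_iUnion_of_subset ⟨0⟩ hc0.ge,
      h.nonempty.mono (Set.subset_iUnion_of_subset ⟨0⟩ hc0.ge), fun x hx y hy => ?_,
      (mk_iUnion_le_of_le h0 _ (by simpa using h0) fun n => hcard _).trans_lt hT⟩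
    obtain ⟨⟨m⟩, hm⟩ := Set.mem_iUnion.1 hx
    obtain ⟨⟨n⟩, hn⟩ := Set.mem_iUnion.1 hy
    refine ⟨ub x y, Set.mem_iUnion.2 ⟨⟨max m n + 1⟩, ?_⟩,
      hub₁ x y, hub₂ x y⟩
    rw [hc]
    exact Or.inr ⟨x, hmono (le_max_left m n) hm, y, hmono (le_max_right m n) hn, rfl⟩

/-- An infinite directed set is the union of a chain, of regular length, of smaller directed
subsets. -/
theorem exists_chain_directedOn [Infinite D] : ∃ θ : Cardinal.{u}, θ.IsRegular ∧
    ∃ s : θ.ord.ToType → Set D, Monotone s ∧ (∀ a, (s a).Nonempty) ∧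
      (∀ a, DirectedOn (· ≤ ·) (s a)) ∧ (∀ a, #(s a) < #D) ∧
      (∀ b : θ.ord.ToType, #(⋃ a : Set.Iio b, s a) < #D) ∧ ∀ d, ∃ a, d ∈ s a := by
  classical
  have h0 : ℵ₀ ≤ #D := aleph0_le_mk D
  have hlim : Order.IsSuccLimit (#D).ord := isSuccLimit_ord h0
  refine ⟨(#D).ord.cof, isRegular_cof hlim, ?_⟩
  obtain ⟨η, -, hη, hηc⟩ := exists_monotone_cofinal (δ := (#D).ord) rfl
  obtain ⟨e⟩ : Nonempty (D ≃ (#D).ord.ToType) := Cardinal.eq.1 (by simp)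
  let r : D → Ordinal.{u} := fun d => (Ordinal.ToType.mk.symm (e d) : Ordinal.{u})
  have hr : ∀ β < (#D).ord, #{d | r d ≤ β} < #D := fun β hβ => by
    let v : (#D).ord.ToType := Ordinal.ToType.mk ⟨Order.succ β, hlim.succ_lt hβ⟩
    have : {d | r d ≤ β} = e ⁻¹' Set.Iio v := by
      ext d
      change r d ≤ β ↔ e d < v
      rw [← Order.lt_succ_iff, ← Ordinal.ToType.mk.symm.lt_iff_lt, OrderIso.symm_apply_apply]
      rfl
    rw [this]
    exact (mk_preimage_of_injective _ _ e.injective).trans_lt (mk_Iio_lt_of_toType v)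
  have hcl : ∀ T : Set D, ∃ T' : Set D, T ⊆ T' ∧ T'.Nonempty ∧ DirectedOn (· ≤ ·) T' ∧
      (#T < #D → #T' < #D) := fun T => by
    by_cases h : #T < #D
    · obtain ⟨T', h1, h2, h3, h4⟩ := exists_directedOn_superset h
      exact ⟨T', h1, h2, h3, fun _ => h4⟩
    · exact ⟨Set.univ, Set.subset_univ _, Set.univ_nonempty,
        directedOn_univ, fun h' => absurd h' h⟩
  choose cl hcl₁ hcl₂ hcl₃ hcl₄ using hcl
  -- By recursion, `s a` is a directed set containing the elements of D of rank at most `η a` and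
  -- all earlier members. The length cof |D| keeps unions over proper initial segments smaller than
  -- D.
  let s : (#D).ord.cof.ord.ToType → Set D := (wellFounded_lt).fix fun a s =>
    cl ({d | r d ≤ η a} ∪ ⋃ b : Set.Iio a, s b b.2)
  have hs : ∀ a, s a = cl ({d | r d ≤ η a} ∪ ⋃ b : Set.Iio a, s b) := fun a =>
    WellFounded.fix_eq _ _ a
  have hIio : ∀ b : (#D).ord.cof.ord.ToType, #(Set.Iio b) < (#D).ord.cof := mk_Iio_lt_of_toType
  have hsub : ∀ b, ⋃ a : Set.Iio b, s a ⊆ s b := fun b => by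
    rw [hs b]
    exact Set.subset_union_right.trans (hcl₁ _)
  have hcard : ∀ a, #(s a) < #D := fun a => by
    induction a using WellFoundedLT.induction with
    | ind a ih =>
      rw [hs]
      exact hcl₄ _ ((mk_union_le _ _).trans_lt (add_lt_of_lt h0 (hr _ (hη a))
        (mk_iUnion_lt_of_lt_cof h0 (hIio a) fun b => ih b b.2)))
  refine ⟨s, fun a b hab => ?_, fun a => ?_, fun a => ?_, hcard,
    fun b => mk_iUnion_lt_of_lt_cof h0 (hIio b) fun a => hcard a, fun d => ?_⟩
  · rcases hab.eq_or_lt with rfl | h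
    · exact le_rfl
    · exact (Set.subset_iUnion (fun a : Set.Iio b => s a) ⟨a, h⟩).trans (hsub b)
  · rw [hs]; exact hcl₂ _
  · rw [hs]; exact hcl₃ _
  · obtain ⟨a, ha⟩ := hηc (r d) (Ordinal.ToType.mk.symm (e d)).2
    refine ⟨a, ?_⟩
    rw [hs]
    exact hcl₁ _ (Or.inl ha)

end Directed

/-! ### Reduction of directed systems to chains -/

section Modules

variable {S : Type u} [Ring S] {D : Type u} [Preorder D] {G : D → Type u}
  [∀ i, AddCommGroup (G i)] [∀ i, Module S (G i)] {f : ∀ i j, i ≤ j → G i →ₗ[S] G j}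

theorem isDirLim_directLimit [DecidableEq D] [IsDirectedOrder D] [Nonempty D] (hid : ∀ i x, f i i le_rfl x = x)
    (hf : ∀ i j k hij hjk x, f j k hjk (f i j hij x) = f i k (hij.trans hjk) x) :
    IsDirLim f (Module.DirectLimit.of S D G f) := by
  have : DirectedSystem G (f · · ·) := ⟨fun i x => hid i x, fun k j i hij hjk x => hf i j k hij hjk x⟩
  exact ⟨fun i j h x => Module.DirectLimit.of_f, fun y => Module.DirectLimit.exists_of y,
    fun i x h => Module.DirectLimit.of.zero_exact h⟩

open Classical in
/-- The direct limit of the restriction of a system to a subset of the index set. -/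
abbrev PartialLimit (f : ∀ i j, i ≤ j → G i →ₗ[S] G j) (s : Set D) : Type u :=
  Module.DirectLimit (fun i : s => G i) fun i j h => f i j h

open Classical in
/-- The canonical maps to the direct limit of the restriction of a system. -/
noncomputable def PartialLimit.of (f : ∀ i j, i ≤ j → G i →ₗ[S] G j) {s : Set D} (i : s) :
    G i →ₗ[S] PartialLimit f s :=
  Module.DirectLimit.of S s (fun i : s => G i) (fun i j h => f i j h) i

open Classical in
theorem PartialLimit.of_f {s : Set D} (i j : s) (h : i ≤ j) (x : G i) :
    PartialLimit.of f j (f i j h x) = PartialLimit.of f i x :=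
  Module.DirectLimit.of_f (f := fun (i j : s) (h : i ≤ j) => f i j h)

open Classical in
/-- The map between the direct limits of restrictions of a system. -/
noncomputable def PartialLimit.map (f : ∀ i j, i ≤ j → G i →ₗ[S] G j) {s t : Set D} (h : s ⊆ t) :
    PartialLimit f s →ₗ[S] PartialLimit f t :=
  Module.DirectLimit.lift S s (fun i : s => G i) (fun i j h => f i j h)
    (fun i => PartialLimit.of f ⟨i, h i.2⟩) fun i j hij x =>
      PartialLimit.of_f (f := f) ⟨i, h i.2⟩ ⟨j, h j.2⟩ hij x

open Classical in
theorem PartialLimit.map_of {s t : Set D} (h : s ⊆ t) (i : s) (x : G i) :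
    PartialLimit.map f h (PartialLimit.of f i x) = PartialLimit.of f ⟨i, h i.2⟩ x :=
  Module.DirectLimit.lift_of (f := fun (i j : s) (h : i ≤ j) => f i j h) _ _ _

open Classical in
theorem PartialLimit.isDirLim (hid : ∀ i x, f i i le_rfl x = x)
    (hf : ∀ i j k hij hjk x, f j k hjk (f i j hij x) = f i k (hij.trans hjk) x) {s : Set D}
    (hs : s.Nonempty) (hd : DirectedOn (· ≤ ·) s) :
    IsDirLim (fun (i j : s) (h : i ≤ j) => f i j h) (PartialLimit.of f) := by
  have := hs.to_subtype
  have : IsDirectedOrder s := ⟨directedOn_iff_directed.1 hd⟩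
  exact isDirLim_directLimit (f := fun (i j : s) (h : i ≤ j) => f i j h) (fun i => hid i) fun i j k => hf i j k

/-- A direct limit of direct limits over a chain of subsets is a direct limit over their union. -/
theorem exists_isDirLim_of_partialLimit (hid : ∀ i x, f i i le_rfl x = x)
    (hf : ∀ i j k hij hjk x, f j k hjk (f i j hij x) = f i k (hij.trans hjk) x) {K : Type*}
    [Preorder K] [IsDirectedOrder K] {s : K → Set D} (hs : Monotone s)
    (hne : ∀ a, (s a).Nonempty) (hd : ∀ a, DirectedOn (· ≤ ·) (s a)) {N : Type u} [AddCommGroup N]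
    [Module S N] {φ : ∀ a, PartialLimit f (s a) →ₗ[S] N}
    (h : IsDirLim (fun a b (hab : a ≤ b) => PartialLimit.map f (hs hab)) φ) {t : Set D}
    (ht : ∀ i, i ∈ t ↔ ∃ a, i ∈ s a) :
    ∃ χ : ∀ i : t, G i →ₗ[S] N, IsDirLim (fun (i j : t) (h : i ≤ j) => f i j h) χ := by
  choose a ha using fun i : t => (ht i).1 i.2
  let χ : ∀ i : t, G i →ₗ[S] N := fun i => φ (a i) ∘ₗ PartialLimit.of f ⟨i, ha i⟩
  have hmap : ∀ b c (hbc : b ≤ c) (i : D) (hi : i ∈ s b) (x : G i),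
      φ b (PartialLimit.of f ⟨i, hi⟩ x) = φ c (PartialLimit.of f ⟨i, hs hbc hi⟩ x) :=
    fun b c hbc i hi x => by
      rw [← h.compat b c hbc, PartialLimit.map_of]
  have hχ : ∀ (i : t) b (hi : (i : D) ∈ s b) (x : G i),
      χ i x = φ b (PartialLimit.of f ⟨i, hi⟩ x) := fun i b hi x => by
    obtain ⟨c, h1, h2⟩ := exists_ge_ge (a i) b
    exact (hmap _ c h1 i (ha i) x).trans (hmap b c h2 i hi x).symm
  refine ⟨χ, fun i j hij x => ?_, fun y => ?_, fun i x hx => ?_⟩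
  · obtain ⟨c, h1, h2⟩ := exists_ge_ge (a i) (a j)
    rw [hχ j c (hs h2 (ha j)), hχ i c (hs h1 (ha i))]
    exact congrArg (φ c) (PartialLimit.of_f (f := f) ⟨i, hs h1 (ha i)⟩ ⟨j, hs h2 (ha j)⟩ hij x)
  · obtain ⟨b, z, rfl⟩ := h.surj y
    obtain ⟨i, x, rfl⟩ := (PartialLimit.isDirLim hid hf (hne b) (hd b)).surj z
    exact ⟨⟨i, (ht i).2 ⟨b, i.2⟩⟩, x, hχ ⟨i, _⟩ b i.2 x⟩
  · obtain ⟨b, hb, h0⟩ := h.zero _ _ hx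
    rw [PartialLimit.map_of] at h0
    obtain ⟨j, hij, hj⟩ := (PartialLimit.isDirLim hid hf (hne b) (hd b)).zero _ _ h0
    exact ⟨⟨j, (ht j).2 ⟨b, j.2⟩⟩, hij, hj⟩

variable {A : ObjectProperty (ModuleCat.{u} S)} {ξ : Cardinal.{u}}

/-- Induction on the size of D; a finite D has a greatest element. For infinite D, the partial
limits along a chain of smaller directed subsets are in A by induction. The chain need not be
continuous: the limit over a proper initial segment is the limit over the union of the subsets
involved, again directed and smaller than D, so `mem_of_isDirLim_chain` applies. -/
theorem mem_of_isDirLim (hstar : AssumptionStar.{u})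
    (hfilt : A = Filt (ltPresentedPart A ξ)) (hξ : ℵ₀ < ξ)
    (hsum : ClosedUnderDirectSummands A)
    (hlim : ClosedUnderContinuousMonoWellOrderedLimits ξ A) (D : Type u) [PartialOrder D]
    [IsDirectedOrder D] [Nonempty D] {G : D → Type u} [∀ i, AddCommGroup (G i)]
    [∀ i, Module S (G i)] {f : ∀ i j, i ≤ j → G i →ₗ[S] G j} (hid : ∀ i x, f i i le_rfl x = x)
    (hf : ∀ i j k hij hjk x, f j k hjk (f i j hij x) = f i k (hij.trans hjk) x)
    (hG : ∀ i, A (ModuleCat.of S (G i))) {N : Type u} [AddCommGroup N] [Module S N]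
    {φ : ∀ i, G i →ₗ[S] N} (hN : IsDirLim f φ) : A (ModuleCat.of S N) := by
  have hA := closedUnderFiltrations_of_eq_filt hfilt
  induction hc : #D using WellFoundedLT.induction generalizing D N with
  | ind c ih =>
  subst hc
  rcases finite_or_infinite D with hD | hD
  · obtain ⟨m, hm⟩ := Finite.exists_le (id : D → D)
    have hinj : Function.Injective (φ m) := by
      rw [injective_iff_map_eq_zero]
      intro x hx
      obtain ⟨j, hmj, h0⟩ := hN.zero m x hx
      rw [← hid m x, ← hf m j m hmj (hm j), h0, map_zero]
    refine hA.of_equiv (LinearEquiv.ofBijective (φ m) ⟨hinj, fun y => ?_⟩) (hG m)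
    obtain ⟨i, x, rfl⟩ := hN.surj y
    exact ⟨f i m (hm i) x, hN.compat i m (hm i) x⟩
  · obtain ⟨θ, hθ, s, hs, hne, hd, hcard, hcard', htop⟩ := exists_chain_directedOn (D := D)
    have ihs : ∀ t : Set D, t.Nonempty → DirectedOn (· ≤ ·) t → #t < #D → ∀ (N : Type u)
        [AddCommGroup N] [Module S N] (φ : ∀ i : t, G i →ₗ[S] N),
        IsDirLim (fun (i j : t) (h : i ≤ j) => f i j h) φ → A (ModuleCat.of S N) := by
      intro t ht htd htc N _ _ φ hφ
      have := ht.to_subtype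
      have : IsDirectedOrder t := ⟨directedOn_iff_directed.1 htd⟩
      exact ih _ htc t (fun i => hid i) (fun i j k => hf i j k) (fun i => hG i) hφ rfl
    have hP := fun a => PartialLimit.isDirLim hid hf (hne a) (hd a)
    have : Nonempty θ.ord.ToType := by
      rw [Ordinal.nonempty_toType_iff]
      exact hθ.ord_pos.ne'
    have hHid : ∀ a (z : PartialLimit f (s a)), PartialLimit.map f (hs (le_refl a)) z = z :=
      fun a z => by
        obtain ⟨i, x, rfl⟩ := (hP a).surj z
        rw [PartialLimit.map_of]
    have hHf : ∀ a b c (hab : a ≤ b) (hbc : b ≤ c) (z : PartialLimit f (s a)),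
        PartialLimit.map f (hs hbc) (PartialLimit.map f (hs hab) z) =
          PartialLimit.map f (hs (hab.trans hbc)) z := fun a b c hab hbc z => by
      obtain ⟨i, x, rfl⟩ := (hP a).surj z
      rw [PartialLimit.map_of, PartialLimit.map_of, PartialLimit.map_of]
    classical
    have hlimit := isDirLim_directLimit hHid hHf
    have key := mem_of_isDirLim_chain hstar hfilt hξ hsum hlim hθ hHid hHf
      (fun a => ihs (s a) (hne a) (hd a) (hcard a) _ _ (hP a)) (fun b hb N _ _ φ hφ => by
        obtain ⟨χ, hχ⟩ := exists_isDirLim_of_partialLimit hid hf (K := Set.Iio b)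
          (s := fun a => s a) (fun a a' h => hs h) (fun a => hne a) (fun a => hd a) hφ
          (t := ⋃ a : Set.Iio b, s a) (fun i => Set.mem_iUnion)
        obtain ⟨a, ha⟩ := hb
        refine ihs _ ?_ ?_ (hcard' b) N χ hχ
        · exact (hne a).mono (Set.subset_iUnion (fun a : Set.Iio b => s a) ⟨a, ha⟩)
        · exact Set.directedOn_iUnion (Monotone.directed_le fun a a' h => hs h) fun a => hd a)
      hlimit
    obtain ⟨χ, hχ⟩ := exists_isDirLim_of_partialLimit hid hf hs hne hd hlimit (t := Set.univ)
      (fun i => ⟨fun _ => htop i, fun _ => trivial⟩)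
    have hχ' : IsDirLim f fun i => χ ⟨i, trivial⟩ :=
      ⟨fun i j h x => hχ.compat ⟨i, trivial⟩ ⟨j, trivial⟩ h x, fun y => by
        obtain ⟨i, x, rfl⟩ := hχ.surj y
        exact ⟨i, x, rfl⟩, fun i x hx => by
        obtain ⟨j, h, h0⟩ := hχ.zero ⟨i, trivial⟩ x hx
        exact ⟨j, h, h0⟩⟩
    obtain ⟨e⟩ := hχ'.nonempty_equiv hN
    exact hA.of_equiv e key

end Modules

theorem theorem3p5 (hstar : AssumptionStar.{u}) (R : Type u) [Ring R]
    (A : ObjectProperty (ModuleCat.{u} Rᵐᵒᵖ)) (ξ : Cardinal.{u})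
    (hξ : ℵ₀ < ξ) (hreg : ξ.IsRegular)
    (hfilt : A = Filt (ltPresentedPart A ξ))
    (hsum : ClosedUnderDirectSummands A)
    (hlim : ClosedUnderContinuousMonoWellOrderedLimits ξ A) :
    ClosedUnderDirectLimits A := by
  intro I _ _ _ F hF c ⟨hc⟩
  refine mem_of_isDirLim hstar hfilt hξ hsum hlim I (f := transition F) (fun i x => ?_)
    (fun i j k hij hjk x => ?_) hF (isDirLim_of_isColimit F c hc)
  · exact ConcreteCategory.congr_hom (F.map_id i) x
  · exact ConcreteCategory.congr_hom (F.map_comp (homOfLE hij) (homOfLE hjk)).symm x
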